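/- Let $G$ be a simple graph, finite or infinite and not necessarily connected, that is subcubic, i.e. every vertex of $G$ has at most three neighbors. Then $G$ is $(1,1,2,2,3)$-packing colorable: the vertices of $G$ can be colored with five colors $1_a,1_b,2_a,2_b,3$ such that any two distinct vertices of color $1_a$, and any two distinct vertices of color $1_b$, are at distance greater than $1$ in $G$; any two distinct vertices of color $2_a$, and any two distinct vertices of color $2_b$, are at distance greater than $2$ in $G$; and any two distinct vertices of color $3$ are at distance greater than $3$ in $G$. Here vertices in different components are at infinite distance, and color classes may be empty. Equivalently, $V(G)$ is a disjoint union of two independent sets, two $2$-packings and one $3$-packing, where a $d$-packing is a set of vertices at pairwise distance greater than $d$. -/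

import Mathlib

/-- A graph is subcubic if every vertex has at most three neighbours. -/
def SimpleGraph.IsSubcubic {V : Type*} (G : SimpleGraph V) : Prop :=
  ∀ v : V, (G.neighborSet v).encard ≤ 3

/-- A set `X` of vertices is a `d`-packing if any two distinct vertices of `X` are at distance
greater than `d` in `G`; vertices in different components are at infinite distance. -/
def SimpleGraph.IsPacking {V : Type*} (G : SimpleGraph V) (d : ℕ) (X : Set V) : Prop :=
  ∀ u ∈ X, ∀ v ∈ X, u ≠ v → (d : ℕ∞) < G.edist u v

/-- `c` is an `S`-packing coloring of `G`, for `S = (S 0, …, S (k - 1))`, if the vertices of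
color `i` form an `S i`-packing. Repeated entries of `S` are distinct colors. -/
def SimpleGraph.IsPackingColoring {V : Type*} (G : SimpleGraph V) {k : ℕ} (S : Fin k → ℕ)
    (c : V → Fin k) : Prop :=
  ∀ i : Fin k, G.IsPacking (S i) {v | c v = i}

/-- `G` is `S`-packing colorable if it has an `S`-packing coloring. -/
def SimpleGraph.PackingColorable {V : Type*} (G : SimpleGraph V) {k : ℕ} (S : Fin k → ℕ) : Prop :=
  ∃ c : V → Fin k, G.IsPackingColoring S c

/-! For finite `G`, take a maximum cut `χ`. Since degrees are at most three, each vertex has at most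
one neighbour on its own side, its mate. Select one end of every edge inside a side: off the
selected set `R` the two sides are independent and take the colors 1. It remains to color `R` with
2, 2, 3.

Flipping a linked set `X` of selected vertices together with the vertices through which it is linked
cannot enlarge the cut. This bounds the number of link edges on `X` by `#X`
(`card_linkEdges_add_le`). Hence a link component has at most one cycle: its bipartition gives the
two colors 2, after at most one vertex is removed to take color 3. A hit on the component lowers the
bound by one and makes it a tree.

Selected vertices within distance 2 that are not linked lie on opposite sides and are both hit
(`link_or_hits_of_near`). Coloring each hit vertex by its side separates them, which is possible
because no component is hit twice (`not_isDoublyHit`). Paths of length 3 between vertices of color 3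
are excluded by `not_hits_mate_mate`, `not_link_mate_of_odd` and `not_adj_of_odd`, according to
which of their edges lie in the cut. These facts rest on the extremal choice of cut and selection.

Infinite graphs follow by compactness, through Rado's selection lemma. -/

section
open Finset
open scoped Classical

namespace SimpleGraph
-- Maximum cuts and mates
noncomputable section

variable {V : Type*}

/-- The sign of a pair of vertices with respect to the cut `χ`: `1` for an edge of the cut, `-1` for
any other edge, `0` for a pair that is not an edge. -/
def cutSign (G : SimpleGraph V) (χ : V → Bool) (u v : V) : ℤ :=
  if G.Adj u v then (if χ u = χ v then -1 else 1) else 0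

/-- A vertex is monochromatic if it has a neighbour on its own side of the cut. -/
def IsBad (G : SimpleGraph V) (χ : V → Bool) (v : V) : Prop := ∃ w, G.Adj v w ∧ χ v = χ w

/-- The neighbour on the same side of the cut (the vertex itself if there is none). -/
def mate (G : SimpleGraph V) (χ : V → Bool) (v : V) : V :=
  if h : G.IsBad χ v then h.choose else v

/-- No two vertices of `X` are joined by an edge inside a side of the cut. -/
def IsMateFree (G : SimpleGraph V) (χ : V → Bool) (X : Finset V) : Prop :=
  ∀ x ∈ X, G.IsBad χ x ∧ G.mate χ x ∉ X

/-- An edge of the cut both of whose ends have a neighbour on their own side. -/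
def Hits (G : SimpleGraph V) (χ : V → Bool) (u v : V) : Prop :=
  G.IsBad χ u ∧ G.IsBad χ v ∧ G.Adj u v ∧ χ u ≠ χ v

lemma Hits.symm {G : SimpleGraph V} {χ : V → Bool} {u v : V} (H : G.Hits χ u v) : G.Hits χ v u :=
  ⟨H.2.1, H.1, H.2.2.1.symm, H.2.2.2.symm⟩

variable [Fintype V]

/-- The signed number of edges leaving `T`. -/
def signedBoundary (G : SimpleGraph V) (χ : V → Bool) (T : Finset V) : ℤ :=
  ∑ u ∈ T, ∑ v ∈ Tᶜ, G.cutSign χ u v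

/-- A maximum cut of a subcubic graph with as many vertices as possible on the side `true`. -/
structure IsOptimalCut (G : SimpleGraph V) (χ : V → Bool) : Prop where
  degree_le : ∀ v, G.degree v ≤ 3
  boundary_nonneg : ∀ T, 0 ≤ G.signedBoundary χ T
  balance : ∀ T, G.signedBoundary χ T = 0 → #{v ∈ T | χ v = false} ≤ #{v ∈ T | χ v = true}

variable {G : SimpleGraph V} {χ : V → Bool}

omit [Fintype V] in
lemma cutSign_comm (u v : V) : G.cutSign χ u v = G.cutSign χ v u := by
  simp only [cutSign, G.adj_comm u v, eq_comm (a := χ u)]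

/-- Only pairs across the boundary of `T` change sign. Each such pair occurs in both orders and
changes by twice its sign, whence the factor 4. -/
lemma sum_cutSign_flip (T : Finset V) :
    ∑ u, ∑ v, G.cutSign (fun v => if v ∈ T then !χ v else χ v) u v
      = ∑ u, ∑ v, G.cutSign χ u v - 4 * G.signedBoundary χ T := by
  have key : ∀ ψ : V → Bool, ∑ u, ∑ v, G.cutSign ψ u v
      = (∑ u ∈ T, ∑ v ∈ T, G.cutSign ψ u v + ∑ u ∈ Tᶜ, ∑ v ∈ Tᶜ, G.cutSign ψ u v)
        + 2 * ∑ u ∈ T, ∑ v ∈ Tᶜ, G.cutSign ψ u v := by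
    intro ψ
    have hc : ∑ u ∈ Tᶜ, ∑ v ∈ T, G.cutSign ψ u v = ∑ u ∈ T, ∑ v ∈ Tᶜ, G.cutSign ψ u v := by
      rw [sum_comm]
      exact sum_congr rfl fun u _ => sum_congr rfl fun v _ => cutSign_comm _ _
    rw [← sum_add_sum_compl T]
    simp_rw [← sum_add_sum_compl T (fun v => G.cutSign ψ _ v)]
    rw [sum_add_distrib, sum_add_distrib, hc]
    ring
  set ψ : V → Bool := fun v => if v ∈ T then !χ v else χ v with hψ
  have h1 : ∑ u ∈ T, ∑ v ∈ T, G.cutSign ψ u v = ∑ u ∈ T, ∑ v ∈ T, G.cutSign χ u v := by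
    refine sum_congr rfl fun u hu => sum_congr rfl fun v hv => ?_
    simp [cutSign, hψ, hu, hv]
  have h2 : ∑ u ∈ Tᶜ, ∑ v ∈ Tᶜ, G.cutSign ψ u v = ∑ u ∈ Tᶜ, ∑ v ∈ Tᶜ, G.cutSign χ u v := by
    refine sum_congr rfl fun u hu => sum_congr rfl fun v hv => ?_
    rw [mem_compl] at hu hv
    simp [cutSign, hψ, hu, hv]
  have h3 : ∑ u ∈ T, ∑ v ∈ Tᶜ, G.cutSign ψ u v = - ∑ u ∈ T, ∑ v ∈ Tᶜ, G.cutSign χ u v := by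
    rw [← sum_neg_distrib]
    refine sum_congr rfl fun u hu => ?_
    rw [← sum_neg_distrib]
    refine sum_congr rfl fun v hv => ?_
    rw [mem_compl] at hv
    simp only [cutSign, hψ, hu, hv, if_true, if_false]
    cases χ u <;> cases χ v <;> simp <;> split_ifs <;> rfl
  rw [key ψ, key χ, h1, h2, h3, signedBoundary]
  ring

lemma card_true_flip (T : Finset V) :
    #{v | (if v ∈ T then !χ v else χ v) = true} + #{v ∈ T | χ v = true}
      = #{v | χ v = true} + #{v ∈ T | χ v = false} := by
  have h : ∀ ψ : V → Bool, #{v | ψ v = true} = #{v ∈ T | ψ v = true} + #{v ∈ Tᶜ | ψ v = true} := by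
    intro ψ
    rw [← card_union_of_disjoint, ← filter_union, union_compl]
    exact disjoint_filter_filter disjoint_compl_right
  rw [h, h χ]
  have h1 : {v ∈ T | (if v ∈ T then !χ v else χ v) = true} = {v ∈ T | χ v = false} := by
    refine filter_congr fun v hv => ?_
    simp [hv]
  have h2 : {v ∈ Tᶜ | (if v ∈ T then !χ v else χ v) = true} = {v ∈ Tᶜ | χ v = true} := by
    refine filter_congr fun v hv => ?_
    rw [mem_compl] at hv
    simp [hv]
  rw [h1, h2]
  ring

theorem exists_isOptimalCut (G : SimpleGraph V) (h3 : ∀ v, G.degree v ≤ 3) :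
    ∃ χ, G.IsOptimalCut χ := by
  -- The weight `Fintype.card V + 1` exceeds any change of the second summand, so the maximum is
  -- lexicographic.
  obtain ⟨χ, hχ⟩ := Finite.exists_max fun χ : V → Bool =>
    (∑ u, ∑ v, G.cutSign χ u v) * (Fintype.card V + 1) + #{v | χ v = true}
  have key : ∀ T, 0 ≤ 4 * G.signedBoundary χ T * (Fintype.card V + 1)
      + #{v ∈ T | χ v = true} - #{v ∈ T | χ v = false} := by
    intro T
    have h := hχ fun v => if v ∈ T then !χ v else χ v
    have h' := card_true_flip (χ := χ) T
    simp only [sum_cutSign_flip] at h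
    zify at h'
    nlinarith
  refine ⟨χ, h3, fun T => ?_, fun T hT => ?_⟩
  · by_contra! hneg
    have h := key T
    have hc : #{v ∈ T | χ v = true} ≤ Fintype.card V := card_le_univ _
    zify at hc
    nlinarith
  · have h := key T
    rw [hT] at h
    zify
    linarith

lemma signedBoundary_eq (T : Finset V) : G.signedBoundary χ T
    = ∑ u ∈ T, ∑ v, G.cutSign χ u v - ∑ u ∈ T, ∑ v ∈ T, G.cutSign χ u v := by
  rw [signedBoundary, ← sum_sub_distrib]
  refine sum_congr rfl fun u _ => ?_
  rw [← sum_add_sum_compl T]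
  ring

lemma signedBoundary_union {S T : Finset V} (h : Disjoint S T) : G.signedBoundary χ (S ∪ T)
    = G.signedBoundary χ S + G.signedBoundary χ T - 2 * ∑ u ∈ S, ∑ v ∈ T, G.cutSign χ u v := by
  have hc : ∑ u ∈ T, ∑ v ∈ S, G.cutSign χ u v = ∑ u ∈ S, ∑ v ∈ T, G.cutSign χ u v := by
    rw [sum_comm]
    exact sum_congr rfl fun u _ => sum_congr rfl fun v _ => cutSign_comm _ _
  simp only [signedBoundary_eq, sum_union h, sum_add_distrib, hc]
  ring

lemma sum_cutSign (v : V) : ∑ w, G.cutSign χ v w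
    = #{w ∈ G.neighborFinset v | χ v ≠ χ w} - #{w ∈ G.neighborFinset v | χ v = χ w} := by
  have : ∀ w, G.cutSign χ v w =
      (if w ∈ ({w ∈ G.neighborFinset v | χ v ≠ χ w} : Finset V) then 1 else 0)
      - (if w ∈ ({w ∈ G.neighborFinset v | χ v = χ w} : Finset V) then 1 else 0) := by
    intro w
    simp only [cutSign, mem_filter, mem_neighborFinset]
    by_cases h : G.Adj v w <;> by_cases h' : χ v = χ w <;> simp [h, h']
  simp only [this, sum_sub_distrib, sum_ite_mem, univ_inter, sum_const, mul_one, nsmul_eq_mul]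

lemma card_ne_add_card_eq (v : V) : #{w ∈ G.neighborFinset v | χ v ≠ χ w}
    + #{w ∈ G.neighborFinset v | χ v = χ w} = G.degree v := by
  rw [add_comm, card_filter_add_card_filter_not, card_neighborFinset_eq_degree]

namespace IsOptimalCut
variable (h : G.IsOptimalCut χ)
include h

lemma sum_cutSign_le (v : V) : ∑ w, G.cutSign χ v w ≤ 3 := by
  rw [sum_cutSign]
  have := card_ne_add_card_eq (G := G) (χ := χ) v
  have := h.degree_le v
  lia

lemma sum_cutSign_le_one {v : V} (hv : G.IsBad χ v) : ∑ w, G.cutSign χ v w ≤ 1 := by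
  rw [sum_cutSign]
  have := card_ne_add_card_eq (G := G) (χ := χ) v
  have := h.degree_le v
  obtain ⟨w, hw, hw'⟩ := hv
  have : 0 < #{w ∈ G.neighborFinset v | χ v = χ w} := card_pos.2 ⟨w, by simp [hw, hw']⟩
  lia

/-- With two neighbours on its own side, a vertex would have at most one on the other, and moving it
would enlarge the cut. -/
lemma card_same_le_one (v : V) : #{w ∈ G.neighborFinset v | χ v = χ w} ≤ 1 := by
  have h1 := h.boundary_nonneg {v}
  rw [signedBoundary_eq] at h1
  simp only [sum_singleton, sum_cutSign] at h1
  have := card_ne_add_card_eq (G := G) (χ := χ) v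
  have := h.degree_le v
  have : G.cutSign χ v v = 0 := by simp [cutSign]
  lia

lemma eq_of_same {v w w' : V} (hw : G.Adj v w) (hc : χ v = χ w) (hw' : G.Adj v w')
    (hc' : χ v = χ w') : w = w' :=
  card_le_one.1 (h.card_same_le_one v) w (by simp [hw, hc]) w' (by simp [hw', hc'])

omit h in
omit [Fintype V] in
lemma adj_mate {v : V} (hv : G.IsBad χ v) : G.Adj v (G.mate χ v) := by
  rw [mate, dif_pos hv]
  exact hv.choose_spec.1

omit h in
omit [Fintype V] in
lemma side_mate (v : V) : χ (G.mate χ v) = χ v := by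
  by_cases hv : G.IsBad χ v
  · rw [mate, dif_pos hv]
    exact hv.choose_spec.2.symm
  · rw [mate, dif_neg hv]

omit h in
omit [Fintype V] in
lemma isBad_mate {v : V} (hv : G.IsBad χ v) : G.IsBad χ (G.mate χ v) :=
  ⟨v, (adj_mate hv).symm, side_mate v⟩

lemma eq_mate {v w : V} (hw : G.Adj v w) (hc : χ v = χ w) : w = G.mate χ v :=
  h.eq_of_same hw hc (adj_mate ⟨w, hw, hc⟩) (side_mate v).symm

lemma mate_mate (v : V) : G.mate χ (G.mate χ v) = v := by
  by_cases hv : G.IsBad χ v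
  · exact (h.eq_mate (adj_mate hv).symm (side_mate v)).symm
  · rw [mate, mate, dif_neg hv, dif_neg hv]

omit h in
omit [Fintype V] in
lemma mate_ne {v : V} (hv : G.IsBad χ v) : G.mate χ v ≠ v := (adj_mate hv).ne'

end IsOptimalCut
end

/-! ### The link graph and edge counts from flipping -/

noncomputable section

variable {V : Type*}

/-- Two vertices on the same side are linked if they have a common neighbour on the other side
all of whose edges belong to the cut. -/
def link (G : SimpleGraph V) (χ : V → Bool) : SimpleGraph V where
  Adj x y := x ≠ y ∧ χ x = χ y ∧ ∃ b, ¬ G.IsBad χ b ∧ χ b ≠ χ x ∧ G.Adj b x ∧ G.Adj b y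
  symm := ⟨fun _ _ ⟨h1, h2, b, h3, h4, h5, h6⟩ => ⟨h1.symm, h2.symm, b, h3, h2 ▸ h4, h6, h5⟩⟩
  loopless := ⟨fun _ h => h.1 rfl⟩

variable [Fintype V]

/-- The number of neighbours of `b` in `X`. -/
def degIn (G : SimpleGraph V) (X : Finset V) (b : V) : ℕ := #{x ∈ X | G.Adj b x}

/-- The edges of the link graph inside `X`. -/
def linkEdges (G : SimpleGraph V) (χ : V → Bool) (X : Finset V) : Finset (Sym2 V) :=
  {e ∈ X.sym2 | e ∈ (G.link χ).edgeSet}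

/-- The vertices through which two vertices of `X` are linked. -/
def linkers (G : SimpleGraph V) (χ : V → Bool) (X : Finset V) : Finset V :=
  {b | ¬ G.IsBad χ b ∧ (∀ x ∈ X, χ b ≠ χ x) ∧ 2 ≤ G.degIn X b}

variable {G : SimpleGraph V} {χ : V → Bool}

lemma degIn_le_degree (X : Finset V) (b : V) : G.degIn X b ≤ G.degree b := by
  rw [degIn, ← card_neighborFinset_eq_degree]
  exact card_le_card fun x hx => by simpa using (mem_filter.1 hx).2

omit [Fintype V] in
lemma sum_degIn_comm (X Z : Finset V) : ∑ x ∈ X, G.degIn Z x = ∑ z ∈ Z, G.degIn X z := by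
  simp only [degIn, card_filter]
  rw [sum_comm]
  simp only [G.adj_comm]

omit [Fintype V] in
lemma sum_cutSign_of_ne {X Z : Finset V} (h : ∀ x ∈ X, ∀ z ∈ Z, χ x ≠ χ z) :
    ∑ x ∈ X, ∑ z ∈ Z, G.cutSign χ x z = ∑ z ∈ Z, G.degIn X z := by
  rw [← sum_degIn_comm, Nat.cast_sum]
  refine sum_congr rfl fun x hx => ?_
  rw [degIn, card_filter, Nat.cast_sum]
  refine sum_congr rfl fun z hz => ?_
  by_cases ha : G.Adj x z <;> simp [cutSign, ha, h x hx z hz]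

omit [Fintype V] in
lemma sum_cutSign_of_eq {X : Finset V} (h : ∀ x ∈ X, ∀ z ∈ X, χ x = χ z) :
    ∑ x ∈ X, ∑ z ∈ X, G.cutSign χ x z = - ∑ x ∈ X, (G.degIn X x : ℤ) := by
  rw [← sum_neg_distrib]
  refine sum_congr rfl fun x hx => ?_
  rw [degIn, card_filter, Nat.cast_sum, ← sum_neg_distrib]
  refine sum_congr rfl fun z hz => ?_
  by_cases ha : G.Adj x z <;> simp [cutSign, ha, h x hx z hz]

namespace IsOptimalCut
variable (h : G.IsOptimalCut χ)
include h

/-- The signed degree is at most 1 at a bad vertex and at most 3 elsewhere. Edges between `X` and `F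
∪ Y` become internal and are subtracted from both ends; edges inside `X` have sign `-1`, so
subtracting them adds; `F ∪ Y` spans no edge. -/
lemma signedBoundary_le {X F Y : Finset V} {i : Bool} (hX : ∀ x ∈ X, G.IsBad χ x ∧ χ x = i)
    (hF : ∀ b ∈ F, ¬ G.IsBad χ b ∧ χ b ≠ i) (hY : ∀ y ∈ Y, G.IsBad χ y ∧ χ y ≠ i)
    (hYY : ∀ y ∈ Y, ∀ z ∈ Y, ¬ G.Adj y z) :
    G.signedBoundary χ (X ∪ (F ∪ Y)) ≤ #X + 3 * #F + #Y + ∑ x ∈ X, G.degIn X x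
      - 2 * (∑ b ∈ F, G.degIn X b + ∑ y ∈ Y, G.degIn X y) := by
  have hFY : Disjoint F Y := by
    rw [Finset.disjoint_left]
    exact fun b hb hb' => (hF b hb).1 (hY b hb').1
  have hZ : ∀ b ∈ F ∪ Y, χ b ≠ i := fun b hb => (mem_union.1 hb).elim
    (fun hb' => (hF b hb').2) (fun hb' => (hY b hb').2)
  have hne : ∀ x ∈ X, ∀ z ∈ F ∪ Y, χ x ≠ χ z := fun x hx z hz => by
    rw [(hX x hx).2]; exact (hZ z hz).symm
  have hXZ : Disjoint X (F ∪ Y) := by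
    rw [Finset.disjoint_left]
    exact fun b hb hb' => hne b hb b hb' rfl
  have hsX : ∑ u ∈ X, ∑ v, G.cutSign χ u v ≤ #X := by
    simpa using sum_le_card_nsmul X _ 1 fun x hx => h.sum_cutSign_le_one (hX x hx).1
  have hsF : ∑ u ∈ F, ∑ v, G.cutSign χ u v ≤ 3 * #F := by
    have := sum_le_card_nsmul F _ 3 fun x _ => h.sum_cutSign_le x
    simpa [mul_comm] using this
  have hsY : ∑ u ∈ Y, ∑ v, G.cutSign χ u v ≤ #Y := by
    simpa using sum_le_card_nsmul Y _ 1 fun x hx => h.sum_cutSign_le_one (hY x hx).1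
  have hX' : ∀ x ∈ X, ∀ z ∈ X, χ x = χ z := fun x hx z hz => by rw [(hX x hx).2, (hX z hz).2]
  have hZ' : ∀ x ∈ F ∪ Y, ∀ z ∈ F ∪ Y, χ x = χ z := fun x hx z hz => by
    have := hZ x hx
    have := hZ z hz
    revert this; revert this; cases χ x <;> cases χ z <;> cases i <;> simp
  have hzero : ∑ x ∈ F ∪ Y, (G.degIn (F ∪ Y) x : ℤ) = 0 := by
    refine sum_eq_zero fun x hx => ?_
    rw [degIn, Nat.cast_eq_zero, card_eq_zero, filter_eq_empty_iff]
    intro z hz ha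
    have hc := hZ' x hx z hz
    rcases mem_union.1 hx with hx' | hx'
    · exact (hF x hx').1 ⟨z, ha, hc⟩
    · rcases mem_union.1 hz with hz' | hz'
      · exact (hF z hz').1 ⟨x, ha.symm, hc.symm⟩
      · exact hYY x hx' z hz' ha
  rw [signedBoundary_union hXZ, signedBoundary_eq, signedBoundary_eq, sum_cutSign_of_eq hX',
    sum_cutSign_of_eq hZ', sum_cutSign_of_ne hne, hzero, sum_union hFY, sum_union hFY]
  push_cast
  linarith

omit h in
lemma card_linkEdges_le_sum_choose {X : Finset V} {i : Bool} (hX : ∀ x ∈ X, χ x = i) :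
    #(G.linkEdges χ X) ≤ ∑ b ∈ G.linkers χ X, (G.degIn X b).choose 2 := by
  have hsub : G.linkEdges χ X ⊆ (G.linkers χ X).biUnion
      fun b => ({x ∈ X | G.Adj b x} : Finset V).offDiag.image Sym2.mk.uncurry := by
    intro e
    induction e using Sym2.ind with
    | _ x y =>
      simp only [linkEdges, mem_filter, mk_mem_sym2_iff, mem_edgeSet]
      rintro ⟨⟨hx, hy⟩, hne, -, b, hb, hbx, hax, hay⟩
      refine mem_biUnion.2 ⟨b, mem_filter.2 ⟨mem_univ _, hb, fun z hz => ?_, ?_⟩, ?_⟩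
      · rwa [hX z hz, ← hX x hx]
      · exact one_lt_card.2 ⟨x, by simp [hx, hax], y, by simp [hy, hay], hne⟩
      · exact mem_image.2 ⟨(x, y), by simp [hx, hax, hy, hay, hne], rfl⟩
  refine (card_le_card hsub).trans (card_biUnion_le.trans (sum_le_sum fun b _ => ?_))
  rw [Sym2.card_image_offDiag, degIn]

/-- A linker has `d = 2` or `d = 3` neighbours in `X`, and for both values `d.choose 2 = 2 * d - 3`.
-/
lemma card_linkEdges_le {X : Finset V} {i : Bool} (hX : ∀ x ∈ X, χ x = i) :
    (#(G.linkEdges χ X) : ℤ) ≤ 2 * ∑ b ∈ G.linkers χ X, G.degIn X b - 3 * #(G.linkers χ X) := by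
  have h1 := card_linkEdges_le_sum_choose (G := G) hX
  have h2 : ∑ b ∈ G.linkers χ X, (G.degIn X b).choose 2 + 3 * #(G.linkers χ X)
      ≤ 2 * ∑ b ∈ G.linkers χ X, G.degIn X b := by
    rw [mul_sum, mul_comm, ← smul_eq_mul, ← sum_const, ← sum_add_distrib]
    refine sum_le_sum fun b hb => ?_
    have h3 := (mem_filter.1 hb).2.2.2
    have h4 := (degIn_le_degree X b).trans (h.degree_le b)
    interval_cases G.degIn X b <;> decide
  zify at h1 h2
  push_cast
  linarith

/-- Flip `X`, its linkers and `Y` together: the contribution of the linkers to the boundary is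
exactly the negative of the bound in `card_linkEdges_le`. -/
lemma card_linkEdges_add_le {X Y : Finset V} {i : Bool} (hX : ∀ x ∈ X, G.IsBad χ x ∧ χ x = i)
    (hY : ∀ y ∈ Y, G.IsBad χ y ∧ χ y ≠ i) (hYY : ∀ y ∈ Y, ∀ z ∈ Y, ¬ G.Adj y z) :
    #(G.linkEdges χ X) + 2 * ∑ y ∈ Y, G.degIn X y ≤ #X + #Y + ∑ x ∈ X, G.degIn X x := by
  obtain rfl | ⟨x, hx⟩ := X.eq_empty_or_nonempty
  · simp [linkEdges, degIn]
  have h1 := h.card_linkEdges_le fun x hx => (hX x hx).2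
  have h2 := h.signedBoundary_le hX (F := G.linkers χ X)
    (fun b hb => ⟨(mem_filter.1 hb).2.1, hX x hx |>.2 ▸ (mem_filter.1 hb).2.2.1 x hx⟩) hY hYY
  have h3 := h.boundary_nonneg (X ∪ (G.linkers χ X ∪ Y))
  zify at h1 h2 ⊢
  linarith

lemma sum_degIn_eq_zero {X : Finset V} {i : Bool} (hX : G.IsMateFree χ X) (hi : ∀ x ∈ X, χ x = i) :
    ∑ x ∈ X, G.degIn X x = 0 := by
  refine sum_eq_zero fun x hx => ?_
  rw [degIn, card_eq_zero, filter_eq_empty_iff]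
  intro z hz ha
  exact (hX x hx).2 (h.eq_mate ha (by rw [hi x hx, hi z hz]) ▸ hz)

lemma card_linkEdges_add_le_of_isMateFree {X Y : Finset V} {i : Bool} (hX : G.IsMateFree χ X)
    (hi : ∀ x ∈ X, χ x = i) (hY : ∀ y ∈ Y, G.IsBad χ y ∧ χ y ≠ i)
    (hYY : ∀ y ∈ Y, ∀ z ∈ Y, ¬ G.Adj y z) :
    #(G.linkEdges χ X) + 2 * ∑ y ∈ Y, G.degIn X y ≤ #X + #Y := by
  have := h.card_linkEdges_add_le (fun x hx => ⟨(hX x hx).1, hi x hx⟩) hY hYY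
  rwa [h.sum_degIn_eq_zero hX hi] at this

omit h in
omit [Fintype V] in
lemma degIn_pos {X : Finset V} {u v : V} (hv : v ∈ X) (H : G.Adj u v) : 1 ≤ G.degIn X u :=
  card_pos.2 ⟨v, by simp [hv, H]⟩

omit h in
omit [Fintype V] in
lemma two_le_degIn {X : Finset V} {u v w : V} (hv : v ∈ X) (hw : w ∈ X) (hne : v ≠ w)
    (H : G.Adj u v) (H' : G.Adj u w) : 2 ≤ G.degIn X u :=
  one_lt_card.2 ⟨v, by simp [hv, H], w, by simp [hw, H'], hne⟩

omit h in
lemma bool_eq_of_ne {a b c : Bool} (h : a ≠ c) (h' : b ≠ c) : a = b := by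
  revert h h'; cases a <;> cases b <;> cases c <;> simp

lemma isMateFree_pair {x y : V} (hx : G.IsBad χ x) (hy : G.IsBad χ y) (h' : y ≠ G.mate χ x) :
    G.IsMateFree χ {x, y} := by
  intro z hz
  have hxy : x ≠ G.mate χ y := fun hxy => h' (by rw [hxy, h.mate_mate])
  simp only [mem_insert, mem_singleton] at hz
  rcases hz with rfl | rfl
  · exact ⟨hx, by simp [mate_ne hx, h'.symm]⟩
  · exact ⟨hy, by simp [mate_ne hy, hxy.symm]⟩

/-- A vertex meets at most one edge inside the other side of the cut. -/
lemma eq_or_eq_mate_of_hits {x y z : V} (hy : G.Hits χ x y) (hz : G.Hits χ x z) :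
    z = y ∨ z = G.mate χ y := by
  by_contra! hne
  have hzy : χ z = χ y := bool_eq_of_ne hz.2.2.2.symm hy.2.2.2.symm
  have hi : ∀ v ∈ ({y, z} : Finset V), χ v = χ y := by simp [hzy]
  have := h.card_linkEdges_add_le (Y := {x})
    (fun v hv => ⟨(h.isMateFree_pair hy.2.1 hz.2.1 hne.2 v hv).1, hi v hv⟩)
    (by simpa using ⟨hy.1, hy.2.2.2⟩) (by simp)
  rw [h.sum_degIn_eq_zero (h.isMateFree_pair hy.2.1 hz.2.1 hne.2) hi, card_pair hne.1.symm] at this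
  have h2 := two_le_degIn (G := G) (X := {y, z}) (by simp) (by simp) hne.1.symm hy.2.2.1 hz.2.2.1
  simp only [sum_singleton, card_singleton] at this
  lia

/-- Common neighbours link. -/
lemma link_adj_of_common {x y b : V} (hx : G.IsBad χ x) (hy : G.IsBad χ y) (hne : x ≠ y)
    (hm : y ≠ G.mate χ x) (hs : χ x = χ y) (hb : χ b ≠ χ x) (hbx : G.Adj b x) (hby : G.Adj b y) :
    (G.link χ).Adj x y := by
  refine ⟨hne, hs, b, fun hbad => ?_, hb, hbx, hby⟩
  rcases h.eq_or_eq_mate_of_hits ⟨hbad, hx, hbx, hb⟩ ⟨hbad, hy, hby, hs ▸ hb⟩ with H | H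
  exacts [hne H.symm, hm H]

end IsOptimalCut
end

/-! ### Connected sets in the link graph and their 2-colorings -/

noncomputable section

variable {V : Type*} {G : SimpleGraph V} {χ : V → Bool}

/-- `X` induces a connected subgraph of the link graph. -/
def IsLinked (G : SimpleGraph V) (χ : V → Bool) (X : Finset V) : Prop :=
  ((G.link χ).induce (X : Set V)).Connected

/-- The function `c` properly colors the link graph on `X`. -/
def IsProperOn (G : SimpleGraph V) (χ : V → Bool) (X : Finset V) (c : V → Bool) : Prop :=
  ∀ x ∈ X, ∀ y ∈ X, (G.link χ).Adj x y → c x ≠ c y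

lemma IsProperOn.mono {X Y : Finset V} {c : V → Bool} (h : G.IsProperOn χ X c) (hY : Y ⊆ X) :
    G.IsProperOn χ Y c := fun x hx y hy => h x (hY hx) y (hY hy)

lemma IsLinked.nonempty {X : Finset V} (h : G.IsLinked χ X) : X.Nonempty := by
  obtain ⟨x, hx⟩ := Connected.nonempty h
  exact ⟨x, hx⟩

lemma IsLinked.induction {X : Finset V} (h : G.IsLinked χ X) {p : V → Prop} {x : V} (hx : x ∈ X)
    (hp : p x) (hstep : ∀ y ∈ X, ∀ z ∈ X, (G.link χ).Adj y z → p y → p z) : ∀ y ∈ X, p y := by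
  intro y hy
  obtain ⟨w⟩ := h.preconnected ⟨x, hx⟩ ⟨y, hy⟩
  have : ∀ (a b : (X : Set V)) (w : ((G.link χ).induce (X : Set V)).Walk a b), p a → p b := by
    intro a b w
    induction w with
    | nil => exact id
    | cons hadj _ ih => exact fun ha => ih (hstep _ (Subtype.mem _) _ (Subtype.mem _) hadj ha)
  exact this _ _ w hp

lemma IsLinked.side_eq {X : Finset V} (h : G.IsLinked χ X) {x y : V} (hx : x ∈ X) (hy : y ∈ X) :
    χ y = χ x :=
  h.induction (p := fun y => χ y = χ x) hx rfl (fun _ _ _ _ hadj hy => hadj.2.1 ▸ hy) y hy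

lemma isLinked_of_forall {X : Finset V} {x : V} (hx : x ∈ X)
    (h : ∀ Y ⊆ X, x ∈ Y → (∀ y ∈ Y, ∀ z ∈ X, (G.link χ).Adj y z → z ∈ Y) → Y = X) :
    G.IsLinked χ X := by
  set H := (G.link χ).induce (X : Set V)
  have hY := h {y ∈ X | ∃ hy : y ∈ X, H.Reachable ⟨x, hx⟩ ⟨y, hy⟩} (filter_subset _ _)
    (by simp [hx]) (by
      simp only [mem_filter]
      rintro y ⟨hy, _, hr⟩ z hz hadj
      exact ⟨hz, hz, hr.trans (Adj.reachable (by exact hadj))⟩)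
  have hr : ∀ y : (X : Set V), H.Reachable ⟨x, hx⟩ y := by
    rintro ⟨y, hy'⟩
    have hy : y ∈ X := hy'
    rw [← hY, mem_filter] at hy
    exact hy.2.2
  have : Nonempty (X : Set V) := ⟨⟨x, hx⟩⟩
  exact Connected.mk fun a b => (hr a).symm.trans (hr b)

lemma IsLinked.union {X Y : Finset V} (hX : G.IsLinked χ X) (hY : G.IsLinked χ Y) {x : V}
    (hx : x ∈ X) (hx' : x ∈ Y) : G.IsLinked χ (X ∪ Y) := by
  refine isLinked_of_forall (mem_union_left _ hx) fun Z hZ hxZ hstep =>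
    subset_antisymm hZ (union_subset ?_ ?_)
  · exact hX.induction hx hxZ fun y _ z hz hadj hy => hstep y hy z (mem_union_left _ hz) hadj
  · exact hY.induction hx' hxZ fun y _ z hz hadj hy => hstep y hy z (mem_union_right _ hz) hadj

/-- A connected set with few link edges can be properly `2`-colored, up to one edge. -/
lemma IsLinked.exists_coloring {X : Finset V} (h : G.IsLinked χ X) :
    ∃ (c : V → Bool) (E : Finset (Sym2 V)), E ⊆ G.linkEdges χ X ∧ #E + 1 = #X ∧
      (∀ x ∈ X, ∀ y ∈ X, s(x, y) ∈ E → c x ≠ c y) ∧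
      ∀ x ∈ X, X ≠ {x} → ∃ z ∈ X, s(x, z) ∈ E := by
  -- A spanning tree supplies both `E`, its edges, and `c`, its 2-coloring.
  obtain ⟨T, hle, hT⟩ := Connected.exists_isTree_le h
  obtain ⟨C⟩ := hT.colorable_two
  have hinj : Function.Injective
      (Sym2.map (Subtype.val : {x // x ∈ (X : Set V)} → V)) :=
    Sym2.map.injective (f := (Subtype.val : {x // x ∈ (X : Set V)} → V)) Subtype.val_injective
  have hmem : ∀ {x y : V} (hx : x ∈ X) (hy : y ∈ X),
      s(x, y) ∈ T.edgeFinset.image (Sym2.map (Subtype.val : {x // x ∈ (X : Set V)} → V)) ↔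
        T.Adj ⟨x, hx⟩ ⟨y, hy⟩ := by
    intro x y hx hy
    have : s(x, y) = Sym2.map (Subtype.val : {x // x ∈ (X : Set V)} → V) s(⟨x, hx⟩, ⟨y, hy⟩) := rfl
    rw [this, hinj.mem_finset_image, mem_edgeFinset, mem_edgeSet]
  refine ⟨fun v => if hv : v ∈ X then decide (C ⟨v, hv⟩ = 0) else false,
    T.edgeFinset.image (Sym2.map Subtype.val), ?_, ?_, ?_, ?_⟩
  · intro e he
    obtain ⟨e', he', rfl⟩ := mem_image.1 he
    clear he
    induction e' using Sym2.ind with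
    | _ x y =>
      have hadj : (G.link χ).Adj x y := hle (by simpa using he')
      simpa [linkEdges] using hadj
  · rw [card_image_of_injective _ hinj, hT.card_edgeFinset]
    simp
  · intro x hx y hy hxy
    rw [hmem hx hy] at hxy
    have := C.valid hxy
    simp only [hx, hy, dif_pos]
    intro heq
    rw [decide_eq_decide] at heq
    lia
  · intro x hx hne
    have : Nontrivial (X : Set V) := by
      by_contra hnt
      rw [not_nontrivial_iff_subsingleton] at hnt
      refine hne (eq_singleton_iff_unique_mem.2 ⟨hx, fun y hy => ?_⟩)
      exact congrArg Subtype.val (hnt.elim (⟨y, hy⟩ : (X : Set V)) ⟨x, hx⟩)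
    have hpos := hT.connected.preconnected.degree_pos_of_nontrivial ⟨x, hx⟩
    obtain ⟨z, hz⟩ := (T.degree_pos_iff_exists_adj _).1 hpos
    exact ⟨z, z.2, (hmem hx z.2).2 hz⟩

lemma IsLinked.card_le {X : Finset V} (h : G.IsLinked χ X) : #X ≤ #(G.linkEdges χ X) + 1 := by
  obtain ⟨c, E, hE, hc, -⟩ := h.exists_coloring
  have := card_le_card hE
  lia

lemma IsLinked.exists_isProperOn {X : Finset V} (h : G.IsLinked χ X)
    (hX : #(G.linkEdges χ X) + 1 ≤ #X) : ∃ c, G.IsProperOn χ X c := by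
  obtain ⟨c, E, hE, hcard, hc, -⟩ := h.exists_coloring
  have := eq_of_subset_of_card_le hE (by lia)
  refine ⟨c, fun x hx y hy hadj => hc x hx y hy ?_⟩
  rw [this]
  simpa [linkEdges, hx, hy] using hadj

lemma IsLinked.exists_isProperOn_erase {X : Finset V} (h : G.IsLinked χ X)
    (hX : #(G.linkEdges χ X) ≤ #X) (hb : ¬ ∃ c, G.IsProperOn χ X c) :
    ∃ w ∈ X, (∃ c, G.IsProperOn χ (X.erase w) c) ∧
      ∃ u ∈ X, ∃ z ∈ X, u ≠ z ∧ (G.link χ).Adj w u ∧ (G.link χ).Adj w z := by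
  obtain ⟨c, E, hE, hcard, hc, hn⟩ := h.exists_coloring
  have hnp : ¬ G.IsProperOn χ X c := fun hp => hb ⟨c, hp⟩
  simp only [IsProperOn, not_forall] at hnp
  obtain ⟨x, hx, y, hy, hadj, hxy⟩ := hnp
  have hmem : s(x, y) ∈ G.linkEdges χ X := by simpa [linkEdges, hx, hy] using hadj
  have hnot : s(x, y) ∉ E := fun hxyE => hxy (hc x hx y hy hxyE)
  -- The edge count leaves `s(x, y)` as the only link edge outside the tree, so deleting `x`
  -- suffices. Its neighbours `y` and `z`, the latter along the tree, are distinct.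
  have hins : insert s(x, y) E = G.linkEdges χ X := by
    refine eq_of_subset_of_card_le (insert_subset hmem hE) ?_
    rw [card_insert_of_notMem hnot]
    lia
  obtain ⟨z, hz, hxz⟩ := hn x hx (by
    rintro rfl
    exact hadj.1 (mem_singleton.1 hy).symm)
  refine ⟨x, hx, ⟨c, fun a ha b hb hab => ?_⟩, y, hy, z, hz, ?_, hadj, ?_⟩
  · rw [mem_erase] at ha hb
    refine hc a ha.2 b hb.2 ?_
    have : s(a, b) ∈ insert s(x, y) E := by
      rw [hins]
      simpa [linkEdges, ha.2, hb.2] using hab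
    refine (mem_insert.1 this).resolve_left fun heq => ?_
    have : x ∈ s(a, b) := heq ▸ Sym2.mem_mk_left x y
    rcases Sym2.mem_iff.1 this with rfl | rfl
    exacts [ha.1 rfl, hb.1 rfl]
  · rintro rfl
    exact hnot hxz
  · have := hE hxz
    simpa [linkEdges, hx, hz] using this

end

/-! ### Hits, odd sets and zero boundaries -/

noncomputable section

variable {V : Type*} [Fintype V] {G : SimpleGraph V} {χ : V → Bool}

lemma mem_linkers {X : Finset V} {b : V} : b ∈ G.linkers χ X ↔
    ¬ G.IsBad χ b ∧ (∀ x ∈ X, χ b ≠ χ x) ∧ 2 ≤ G.degIn X b := by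
  simp [linkers]

lemma link_adj_of_mem_linkers {X : Finset V} {b x y : V} (hb : b ∈ G.linkers χ X) (hx : x ∈ X)
    (hy : y ∈ X) (hne : x ≠ y) (hbx : G.Adj b x) (hby : G.Adj b y) : (G.link χ).Adj x y := by
  obtain ⟨h1, h2, -⟩ := mem_linkers.1 hb
  exact ⟨hne, IsOptimalCut.bool_eq_of_ne (h2 x hx).symm (h2 y hy).symm, b, h1, h2 x hx, hbx, hby⟩

lemma exists_mem_linkers_of_adj {X : Finset V} (hX : G.IsLinked χ X) {x y : V} (hx : x ∈ X)
    (hy : y ∈ X) (hadj : (G.link χ).Adj x y) :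
    ∃ b ∈ G.linkers χ X, G.Adj b x ∧ G.Adj b y := by
  obtain ⟨hne, -, b, hb, hbx, hax, hay⟩ := hadj
  refine ⟨b, mem_linkers.2 ⟨hb, fun z hz => ?_, IsOptimalCut.two_le_degIn hx hy hne hax hay⟩,
    hax, hay⟩
  rwa [hX.side_eq hx hz]

omit [Fintype V] in
lemma cutSign_nonneg_of_not_isBad {u v : V} (hu : ¬ G.IsBad χ u) : 0 ≤ G.cutSign χ u v := by
  unfold cutSign
  split_ifs with h1 h2
  · exact (hu ⟨v, h1, h2⟩).elim
  all_goals simp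

omit [Fintype V] in
lemma cutSign_nonneg_of_ne {u v : V} (h : χ u ≠ χ v) : 0 ≤ G.cutSign χ u v := by
  unfold cutSign
  split_ifs <;> simp

omit [Fintype V] in
lemma cutSign_eq_one {u v : V} (ha : G.Adj u v) (h : χ u ≠ χ v) : G.cutSign χ u v = 1 := by
  simp [cutSign, ha, h]

omit [Fintype V] in
lemma one_le_sum_cutSign {S T : Finset V} (hnn : ∀ u ∈ S, ∀ v ∈ T, 0 ≤ G.cutSign χ u v) {a b : V}
    (ha : a ∈ S) (hb : b ∈ T) (hab : G.Adj a b) (hne : χ a ≠ χ b) :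
    1 ≤ ∑ u ∈ S, ∑ v ∈ T, G.cutSign χ u v := by
  rw [← cutSign_eq_one hab hne]
  exact (single_le_sum (f := fun v => G.cutSign χ a v) (hnn a ha) hb).trans
    (single_le_sum (f := fun u => ∑ v ∈ T, G.cutSign χ u v)
      (fun u hu => sum_nonneg (hnn u hu)) ha)

namespace IsOptimalCut
variable (h : G.IsOptimalCut χ)
include h

section MateFree
variable {X : Finset V} (hX : G.IsMateFree χ X) (hl : G.IsLinked χ X)
include hX hl

lemma card_linkEdges_le_card : #(G.linkEdges χ X) ≤ #X := by
  obtain ⟨x, hx⟩ := hl.nonempty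
  simpa using h.card_linkEdges_add_le_of_isMateFree hX (fun y hy => hl.side_eq hx hy)
    (Y := ∅) (by simp) (by simp)

lemma card_linkEdges_add_one_le {u v : V} (hv : v ∈ X) (hu : G.Hits χ u v) :
    #(G.linkEdges χ X) + 2 * G.degIn X u ≤ #X + 1 := by
  simpa using h.card_linkEdges_add_le_of_isMateFree hX (fun y hy => hl.side_eq hv hy)
    (Y := {u}) (by simpa using ⟨hu.1, hu.2.2.2⟩) (by simp)

/-- The hit leaves at most `#X - 1` link edges, so the link graph on `X` is a tree. -/
lemma exists_isProperOn_of_hits {u v : V} (hv : v ∈ X) (hu : G.Hits χ u v) :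
    ∃ c, G.IsProperOn χ X c := by
  have h1 := h.card_linkEdges_add_one_le hX hl hv hu
  have h2 := degIn_pos hv hu.2.2.1
  exact hl.exists_isProperOn (by lia)

lemma eq_of_hits_of_hits {u v w : V} (hv : v ∈ X) (hu : G.Hits χ u v) (hw : w ∈ X)
    (hu' : G.Hits χ u w) : v = w := by
  by_contra hne
  have h1 := h.card_linkEdges_add_one_le hX hl hv hu
  have h2 := two_le_degIn hv hw hne hu.2.2.1 hu'.2.2.1
  have h3 := hl.card_le
  lia

/-- Two nonadjacent hitting vertices in `Y` would leave at most `#X - 2` link edges, too few for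
connectedness. So all hits on `X` come from one edge inside a side. -/
lemma eq_or_eq_mate_of_hits_mem {u v u' v' : V} (hv : v ∈ X) (hu : G.Hits χ u v) (hv' : v' ∈ X)
    (hu' : G.Hits χ u' v') : u' = u ∨ u' = G.mate χ u := by
  by_contra! hne
  have hs : χ u' ≠ χ v := hl.side_eq hv hv' ▸ hu'.2.2.2
  have hs' : χ u' = χ u := bool_eq_of_ne hs hu.2.2.2
  have hnadj : ¬ G.Adj u u' := fun ha => hne.2 (h.eq_mate ha hs'.symm)
  have h1 := h.card_linkEdges_add_le_of_isMateFree hX (fun y hy => hl.side_eq hv hy)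
    (Y := {u, u'}) (by simpa using ⟨⟨hu.1, hu.2.2.2⟩, hu'.1, hs⟩)
    (by simpa [G.adj_comm u'] using hnadj)
  rw [sum_pair hne.1.symm, card_pair hne.1.symm] at h1
  have h2 := degIn_pos hv hu.2.2.1
  have h3 := degIn_pos hv' hu'.2.2.1
  have h4 := hl.card_le
  lia

variable (hc : ¬ ∃ c, G.IsProperOn χ X c)
include hc

lemma not_hits_of_not_isProperOn {u v : V} (hv : v ∈ X) : ¬ G.Hits χ u v := fun hu =>
  hc (h.exists_isProperOn_of_hits hX hl hv hu)

/-- A set that is not bipartite has at least `#X` link edges, which makes the flipping inequality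
tight. -/
lemma signedBoundary_linkers_eq_zero : G.signedBoundary χ (X ∪ G.linkers χ X) = 0 := by
  refine le_antisymm ?_ (h.boundary_nonneg _)
  obtain ⟨x, hx⟩ := hl.nonempty
  have h1 := h.signedBoundary_le (X := X) (Y := ∅) (F := G.linkers χ X) (i := χ x)
    (fun y hy => ⟨(hX y hy).1, hl.side_eq hx hy⟩)
    (fun b hb => ⟨(mem_linkers.1 hb).1, (mem_linkers.1 hb).2.1 x hx⟩) (by simp) (by simp)
  rw [h.sum_degIn_eq_zero hX fun y hy => hl.side_eq hx hy, union_empty] at h1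
  have h2 := h.card_linkEdges_le fun y hy => hl.side_eq hx hy
  have h3 : #X ≤ #(G.linkEdges χ X) := by
    by_contra! hlt
    exact hc (hl.exists_isProperOn hlt)
  zify at h3
  simp only [card_empty, sum_empty] at h1
  push_cast at h1 h2
  linarith

/-- The boundary is zero, so the balance condition applies and gives at least as many linkers as
vertices of `X`. Zero boundary then forces the average of `degIn` over the linkers down to 2, its
least possible value. -/
lemma degIn_eq_two_of_mem_linkers (hs : ∀ x ∈ X, χ x = false) :
    ∀ b ∈ G.linkers χ X, G.degIn X b = 2 := by
  have h0 := h.signedBoundary_linkers_eq_zero hX hl hc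
  have hF : ∀ b ∈ G.linkers χ X, χ b = true := by
    obtain ⟨x, hx⟩ := hl.nonempty
    intro b hb
    have := (mem_linkers.1 hb).2.1 x hx
    rw [hs x hx] at this
    simpa using this
  have hbal := h.balance _ h0
  have e1 : {v ∈ X ∪ G.linkers χ X | χ v = false} = X := by
    ext v
    simp only [mem_filter, mem_union]
    refine ⟨fun ⟨hv, hv'⟩ => hv.resolve_right fun hv => ?_, fun hv => ⟨Or.inl hv, hs v hv⟩⟩
    simp [hF v hv] at hv'
  have e2 : {v ∈ X ∪ G.linkers χ X | χ v = true} = G.linkers χ X := by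
    ext v
    simp only [mem_filter, mem_union]
    refine ⟨fun ⟨hv, hv'⟩ => hv.resolve_left fun hv => ?_, fun hv => ⟨Or.inr hv, hF v hv⟩⟩
    simp [hs v hv] at hv'
  rw [e1, e2] at hbal
  have h1 := h.signedBoundary_le (X := X) (Y := ∅) (F := G.linkers χ X) (i := false)
    (fun y hy => ⟨(hX y hy).1, hs y hy⟩)
    (fun b hb => ⟨(mem_linkers.1 hb).1, by simp [hF b hb]⟩) (by simp) (by simp)
  rw [h.sum_degIn_eq_zero hX hs, union_empty, h0] at h1
  simp only [card_empty, sum_empty] at h1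
  push_cast at h1
  intro b hb
  by_contra hne
  have h2 : ∑ b ∈ G.linkers χ X, 2 < ∑ b ∈ G.linkers χ X, G.degIn X b :=
    sum_lt_sum (fun b hb => (mem_linkers.1 hb).2.2)
      ⟨b, hb, lt_of_le_of_ne (mem_linkers.1 hb).2.2 (Ne.symm hne)⟩
  rw [sum_const, smul_eq_mul] at h2
  zify at h2 hbal
  linarith

end MateFree

lemma degIn_le_two {F : Finset V} {x : V} (hx : G.IsBad χ x) (hF : ∀ b ∈ F, χ b ≠ χ x) :
    G.degIn F x ≤ 2 := by
  have h1 : G.mate χ x ∉ ({b ∈ F | G.Adj x b} : Finset V) := fun hm =>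
    hF _ (mem_filter.1 hm).1 (side_mate x)
  have h2 : insert (G.mate χ x) ({b ∈ F | G.Adj x b} : Finset V) ⊆ G.neighborFinset x := by
    intro b hb
    rw [mem_neighborFinset]
    rcases mem_insert.1 hb with rfl | hb
    exacts [adj_mate hx, (mem_filter.1 hb).2]
  have h3 := card_le_card h2
  rw [card_insert_of_notMem h1, card_neighborFinset_eq_degree] at h3
  have := h.degree_le x
  rw [degIn]
  lia

lemma degIn_le_one {F : Finset V} {x y : V} (hF : ∀ b ∈ F, ¬ G.IsBad χ b ∧ χ b ≠ χ x)
    (hy : G.Hits χ y x) : G.degIn F x ≤ 1 := by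
  have h1 := h.degIn_le_two (F := insert y F) (x := x) hy.2.1 (by
    intro b hb
    rcases mem_insert.1 hb with rfl | hb
    exacts [hy.2.2.2, (hF b hb).2])
  rw [degIn, filter_insert, if_pos hy.2.2.1.symm, card_insert_of_notMem] at h1
  · rw [degIn]
    lia
  · exact fun hm => (hF y (mem_filter.1 hm).1).1 hy.1

/-- If `u` is the apex of a triangle over the monochromatic edge `v w`, then a vertex adjacent to
the mate of `u` is not linked to both `v` and `w`. -/
lemma not_isLinked_of_apex {X : Finset V} (hl : G.IsLinked χ X) (hX : ∀ x ∈ X, G.IsBad χ x)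
    {u v z : V} (hv : v ∈ X) (hm : G.mate χ v ∈ X)
    (hmate : ∀ x ∈ X, G.mate χ x ∈ X → x = v ∨ x = G.mate χ v) (hz : z ∈ X) (hzv : z ≠ v)
    (hzm : z ≠ G.mate χ v) (huv : G.Hits χ u v) (hum : G.Hits χ u (G.mate χ v))
    (huz : G.Hits χ (G.mate χ u) z) : False := by
  have hside : ∀ x ∈ X, χ x = χ v := fun x hx => hl.side_eq hv hx
  have hvm : v ≠ G.mate χ v := (mate_ne huv.2.1).symm
  have hdeg : ∑ x ∈ X, G.degIn X x ≤ 2 := by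
    have hsub : ({v, G.mate χ v} : Finset V) ⊆ X := by
      simp [insert_subset_iff, hv, hm]
    rw [← sum_subset hsub]
    · have hle : ∀ x ∈ ({v, G.mate χ v} : Finset V), G.degIn X x ≤ 1 := by
        intro x hx
        refine card_le_one.2 fun a ha b hb => ?_
        rw [mem_filter] at ha hb
        exact h.eq_of_same ha.2 (by rw [hside x (hsub hx), hside a ha.1]) hb.2
          (by rw [hside x (hsub hx), hside b hb.1])
      have := sum_le_card_nsmul _ _ 1 hle
      rwa [card_pair hvm] at this
    · intro x hx hx'
      rw [degIn, card_eq_zero, filter_eq_empty_iff]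
      intro y hy ha
      have hyx := h.eq_mate ha (by rw [hside x hx, hside y hy])
      exact hx' (by simpa using hmate x hx (hyx ▸ hy))
  have hu2 : 2 ≤ G.degIn X u := two_le_degIn hv hm hvm huv.2.2.1 hum.2.2.1
  have hXi : ∀ x ∈ X, G.IsBad χ x ∧ χ x = χ v := fun x hx => ⟨hX x hx, hside x hx⟩
  have hF : ∀ b ∈ G.linkers χ X, ¬ G.IsBad χ b ∧ χ b ≠ χ v := fun b hb =>
    ⟨(mem_linkers.1 hb).1, (mem_linkers.1 hb).2.1 v hv⟩
  have h1 := h.signedBoundary_le hXi hF (Y := {u}) (by simpa using ⟨huv.1, huv.2.2.2⟩) (by simp)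
  have h2 := h.boundary_nonneg (X ∪ (G.linkers χ X ∪ {u}))
  have h3 := h.card_linkEdges_add_le hXi (Y := {u}) (by simpa using ⟨huv.1, huv.2.2.2⟩) (by simp)
  simp only [card_singleton, sum_singleton] at h1 h3
  -- The apex sees two vertices of `X`, which outweighs the edge inside `X`: the link graph on `X`
  -- is a tree, so no linker has three neighbours in `X`.
  obtain ⟨c, hc⟩ := hl.exists_isProperOn (by lia)
  have hdeg2 : ∀ b ∈ G.linkers χ X, G.degIn X b = 2 := by
    intro b hb
    by_contra hne
    have hlt : 2 < G.degIn X b := lt_of_le_of_ne (mem_linkers.1 hb).2.2 (Ne.symm hne)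
    obtain ⟨x, hx, y, hy, w, hw, hxy, hxw, hyw⟩ := two_lt_card.1 hlt
    rw [mem_filter] at hx hy hw
    have e1 := hc x hx.1 y hy.1 (link_adj_of_mem_linkers hb hx.1 hy.1 hxy hx.2 hy.2)
    have e2 := hc x hx.1 w hw.1 (link_adj_of_mem_linkers hb hx.1 hw.1 hxw hx.2 hw.2)
    have e3 := hc y hy.1 w hw.1 (link_adj_of_mem_linkers hb hy.1 hw.1 hyw hy.2 hw.2)
    exact e3 (bool_eq_of_ne e1.symm e2.symm)
  have h4 : #X ≤ #(G.linkers χ X) + 1 := by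
    refine hl.card_le.trans (Nat.add_le_add_right ?_ 1)
    refine (card_linkEdges_le_sum_choose hside).trans ?_
    rw [sum_congr rfl fun b hb => by rw [hdeg2 b hb]]
    simp
  have h5 : ∑ b ∈ G.linkers χ X, G.degIn X b = 2 * #(G.linkers χ X) := by
    rw [sum_congr rfl hdeg2]
    simp [mul_comm]
  have hsub : ({v, G.mate χ v, z} : Finset V) ⊆ X := by
    simp [insert_subset_iff, hv, hm, hz]
  -- Each vertex of `X` meets at most two linkers, and a hit vertex at most one. A tree leaves a
  -- slack of 2 in this count, exceeded by the three hit vertices.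
  have h6 : ∑ x ∈ X, (G.degIn (G.linkers χ X) x
      + if x ∈ ({v, G.mate χ v, z} : Finset V) then 1 else 0) ≤ #X • 2 := by
    refine sum_le_card_nsmul _ _ _ fun x hx => ?_
    have hF' : ∀ b ∈ G.linkers χ X, ¬ G.IsBad χ b ∧ χ b ≠ χ x := fun b hb =>
      ⟨(hF b hb).1, hside x hx ▸ (hF b hb).2⟩
    split_ifs with hx'
    · have : ∃ y, G.Hits χ y x := by
        simp only [mem_insert, mem_singleton] at hx'
        rcases hx' with rfl | rfl | rfl
        exacts [⟨_, huv⟩, ⟨_, hum⟩, ⟨_, huz⟩]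
      obtain ⟨y, hy⟩ := this
      have := h.degIn_le_one hF' hy
      lia
    · exact h.degIn_le_two (hX x hx) fun b hb => (hF' b hb).2
  rw [sum_add_distrib, sum_degIn_comm, h5, sum_ite_mem, inter_eq_right.2 hsub, sum_const,
    card_eq_three.2 ⟨v, G.mate χ v, z, hvm, hzv.symm, hzm.symm, rfl⟩] at h6
  simp only [smul_eq_mul] at h6
  lia

/-- Odd link components on different sides of the cut are not joined by a path of cut edges. -/
lemma not_adj_of_odd {X Y : Finset V} (hX : G.IsMateFree χ X) (hlX : G.IsLinked χ X)
    (hcX : ¬ ∃ c, G.IsProperOn χ X c) (hsX : ∀ x ∈ X, χ x = true)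
    (hY : G.IsMateFree χ Y) (hlY : G.IsLinked χ Y) (hcY : ¬ ∃ c, G.IsProperOn χ Y c)
    (hsY : ∀ y ∈ Y, χ y = false) {r b a s u z : V} (hr : r ∈ X) (hs : s ∈ Y) (hu : u ∈ Y)
    (hz : z ∈ Y) (huz : u ≠ z) (hsu : (G.link χ).Adj s u) (hsz : (G.link χ).Adj s z)
    (hb : χ b = false) (ha : χ a = true) (hrb : G.Adj r b) (hba : G.Adj b a) (has : G.Adj a s) :
    False := by
  have hsbad := (hY s hs).1
  -- The vertex `s` has at most two cut edges, and they lead to the distinct linkers joining it to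
  -- `u` and `z`; hence `a` is one of these.
  have haF : a ∈ G.linkers χ Y := by
    obtain ⟨b₁, hb₁, hs₁, hu₁⟩ := exists_mem_linkers_of_adj hlY hs hu hsu
    obtain ⟨b₂, hb₂, hs₂, hz₂⟩ := exists_mem_linkers_of_adj hlY hs hz hsz
    have hne : b₁ ≠ b₂ := by
      rintro rfl
      have h2 := h.degIn_eq_two_of_mem_linkers hY hlY hcY hsY b₁ hb₁
      have h3 : 2 < G.degIn Y b₁ := two_lt_card.2 ⟨s, by simp [hs, hs₁], u, by simp [hu, hu₁],
        z, by simp [hz, hz₂], hsu.1, hsz.1, huz⟩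
      lia
    by_contra hna
    have h4 := h.degIn_le_two (F := {a, b₁, b₂}) hsbad (by
      have h5 := (mem_linkers.1 hb₁).2.1 s hs
      have h6 := (mem_linkers.1 hb₂).2.1 s hs
      have h7 : χ a ≠ χ s := by rw [ha, hsY s hs]; simp
      simp [h5, h6, h7])
    have h5 : 2 < G.degIn {a, b₁, b₂} s := two_lt_card.2 ⟨a, by simp [has.symm], b₁,
      by simp [hs₁.symm], b₂, by simp [hs₂.symm], ne_of_mem_of_not_mem hb₁ hna |>.symm,
      ne_of_mem_of_not_mem hb₂ hna |>.symm, hne⟩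
    lia
  have hbbad : ¬ G.IsBad χ b := fun hbad =>
    h.not_hits_of_not_isProperOn hX hlX hcX hr ⟨hbad, (hX r hr).1, hrb.symm, by simp [hb, hsX r hr]⟩
  have hFX : ∀ f ∈ G.linkers χ X, ¬ G.IsBad χ f ∧ χ f = false := fun f hf =>
    ⟨(mem_linkers.1 hf).1, by simpa [hsX r hr] using (mem_linkers.1 hf).2.1 r hr⟩
  have hFY : ∀ f ∈ G.linkers χ Y, ¬ G.IsBad χ f ∧ χ f = true := fun f hf =>
    ⟨(mem_linkers.1 hf).1, by simpa [hsY s hs] using (mem_linkers.1 hf).2.1 s hs⟩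
  set T₁ := X ∪ G.linkers χ X
  set T₂ := Y ∪ G.linkers χ Y
  have ht₁ : G.signedBoundary χ T₁ = 0 := h.signedBoundary_linkers_eq_zero hX hlX hcX
  have ht₂ : G.signedBoundary χ T₂ = 0 := h.signedBoundary_linkers_eq_zero hY hlY hcY
  have hT₁ : ∀ v ∈ T₁, (G.IsBad χ v ∧ χ v = true) ∨ (¬ G.IsBad χ v ∧ χ v = false) := fun v hv =>
    (mem_union.1 hv).imp (fun hv => ⟨(hX v hv).1, hsX v hv⟩) (hFX v)
  have hT₂ : ∀ v ∈ T₂, (G.IsBad χ v ∧ χ v = false) ∨ (¬ G.IsBad χ v ∧ χ v = true) := fun v hv =>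
    (mem_union.1 hv).imp (fun hv => ⟨(hY v hv).1, hsY v hv⟩) (hFY v)
  have hdisj : Disjoint T₁ T₂ := by
    rw [Finset.disjoint_left]
    intro v hv hv'
    rcases hT₁ v hv with h1 | h1 <;> rcases hT₂ v hv' with h2 | h2 <;> simp_all
  have hnn : ∀ u ∈ T₁, ∀ v ∈ T₂, 0 ≤ G.cutSign χ u v := by
    intro u hu v hv
    rcases hT₁ u hu with h1 | h1
    · rcases hT₂ v hv with h2 | h2
      · exact cutSign_nonneg_of_ne (by simp [h1.2, h2.2])
      · rw [cutSign_comm]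
        exact cutSign_nonneg_of_not_isBad h2.1
    · exact cutSign_nonneg_of_not_isBad h1.1
  have haT : a ∈ T₂ := mem_union_right _ haF
  have hrT : r ∈ T₁ := mem_union_left _ hr
  -- `T₁` and `T₂` have zero boundary, so a cut edge between them makes the boundary of their union
  -- negative. If `b` lies outside both, adding it costs at most 3, while the edges at `a` and `r`
  -- save 2 each.
  by_cases hbT : b ∈ T₁
  · have h1 := one_le_sum_cutSign hnn hbT haT hba (by simp [ha, hb])
    have h2 := signedBoundary_union (G := G) (χ := χ) hdisj
    have h3 := h.boundary_nonneg (T₁ ∪ T₂)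
    lia
  · have hbT₂ : b ∉ T₂ := fun hm => by
      rcases hT₂ b hm with h1 | h1
      · exact hbbad h1.1
      · simp [hb] at h1
    have hd₁ : Disjoint {b} T₂ := by simpa using hbT₂
    have hd₂ : Disjoint T₁ ({b} ∪ T₂) := by
      rw [disjoint_union_right]
      exact ⟨by simpa using hbT, hdisj⟩
    have h1 := one_le_sum_cutSign (S := {b}) (T := T₂) (G := G) (χ := χ)
      (by simpa using fun v _ => cutSign_nonneg_of_not_isBad hbbad) (by simp) haT hba
      (by simp [ha, hb])
    have h2 := one_le_sum_cutSign (S := T₁) (T := {b} ∪ T₂) (G := G) (χ := χ) (by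
      intro u hu v hv
      rcases mem_union.1 hv with hv | hv
      · rw [mem_singleton.1 hv, cutSign_comm]
        exact cutSign_nonneg_of_not_isBad hbbad
      · exact hnn u hu v hv) hrT (mem_union_left _ (mem_singleton_self b)) hrb
      (by simp [hb, hsX r hr])
    have h3 : G.signedBoundary χ {b} ≤ 3 := by
      rw [signedBoundary_eq]
      have := h.sum_cutSign_le b
      simpa [cutSign] using this
    have h4 := signedBoundary_union (G := G) (χ := χ) hd₁
    have h5 := signedBoundary_union (G := G) (χ := χ) hd₂
    have h6 := h.boundary_nonneg (T₁ ∪ ({b} ∪ T₂))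
    lia

end IsOptimalCut
end
end SimpleGraph

/-! ### Two-valued functions reversed by involutions -/

/-- A fixed-point-free involution flips a two-valued function. -/
lemma Function.Involutive.exists_bool_ne {α : Type*} {f : α → α} (hf : Function.Involutive f)
    (hne : ∀ x, f x ≠ x) : ∃ q : α → Bool, ∀ x, q (f x) ≠ q x := by
  obtain ⟨r, hr⟩ := exists_wellFoundedLT α
  refine ⟨fun x => decide (x < f x), fun x hx => ?_⟩
  rw [decide_eq_decide, hf x] at hx
  rcases lt_or_gt_of_ne (hne x) with h | h
  · exact lt_asymm h (hx.1 h)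
  · exact lt_asymm h (hx.2 h)

/-- Two fixed-point-free involutions flip a common two-valued function. -/
lemma Equiv.Perm.exists_bool_ne_of_involutive {α : Type*} {m d : Equiv.Perm α}
    (hm : Function.Involutive m) (hd : Function.Involutive d) (hm' : ∀ x, m x ≠ x)
    (hd' : ∀ x, d x ≠ x) : ∃ q : α → Bool, ∀ x, q (m x) ≠ q x ∧ q (d x) ≠ q x := by
  have hmm : m * m = 1 := Equiv.ext hm
  have hdd : d * d = 1 := Equiv.ext hd
  -- On the cycles of `t` the involutions `m` and `d` induce the same map, so it is enough that this
  -- map fixes no cycle.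
  set t := d * m with ht
  have hconj : ∀ k : ℤ, m * t ^ k = t ^ (-k) * m := by
    intro k
    have hmi : m⁻¹ = m := inv_eq_of_mul_eq_one_left hmm
    have hdi : d⁻¹ = d := inv_eq_of_mul_eq_one_left hdd
    have h1 : m * t * m⁻¹ = t⁻¹ := by
      rw [ht, mul_inv_rev, hmi, hdi, mul_assoc, mul_assoc, hmm, mul_one]
    have h2 : m * t ^ k * m⁻¹ = t ^ (-k) := by rw [← conj_zpow, h1, inv_zpow, zpow_neg]
    rw [← h2, mul_assoc, inv_mul_cancel, mul_one]
  have hmt : ∀ (k : ℤ) x, m ((t ^ k) x) = (t ^ (-k)) (m x) := fun k x =>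
    DFunLike.congr_fun (hconj k) x
  have hadd : ∀ (k l : ℤ) x, (t ^ k) ((t ^ l) x) = (t ^ (k + l)) x := fun k l x => by
    rw [zpow_add, Equiv.Perm.mul_apply]
  -- A reflection of a cycle has a fixed point of `m` if the exponent is even and of `d` if it is
  -- odd.
  have hkey : ∀ x, ¬ t.SameCycle x (m x) := by
    rintro x ⟨k, hk⟩
    rcases Int.even_or_odd' k with ⟨j, rfl | rfl⟩
    · apply hm' ((t ^ j) x)
      rw [hmt, ← hk, hadd]
      congr 2
      ring
    · apply hd' ((t ^ (j + 1)) x)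
      have h1 : m ((t ^ j) x) = (t ^ (j + 1)) x := by
        rw [hmt, ← hk, hadd]
        congr 2
        ring
      have h2 : (t ^ (j + 1)) x = t ((t ^ j) x) := by
        rw [add_comm, zpow_add, zpow_one, Equiv.Perm.mul_apply]
      rw [← h1]
      exact h2.symm.trans h1.symm
  let s := Equiv.Perm.SameCycle.setoid t
  have hmap : ∀ x y, t.SameCycle x y → t.SameCycle (m x) (m y) := by
    rintro x y ⟨k, rfl⟩
    refine ⟨-k, ?_⟩
    rw [← Equiv.Perm.mul_apply, ← Equiv.Perm.mul_apply, hconj]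
  let f : Quotient s → Quotient s := Quotient.map m hmap
  have hf : Function.Involutive f := by
    intro x
    induction x using Quotient.inductionOn with
    | _ x => simp [f, hm x]
  obtain ⟨q, hq⟩ := hf.exists_bool_ne (by
    intro x
    induction x using Quotient.inductionOn with
    | _ x =>
      intro hx
      exact hkey x (Quotient.exact hx).symm)
  refine ⟨fun x => q ⟦x⟧, fun x => ⟨hq ⟦x⟧, ?_⟩⟩
  have : (⟦d x⟧ : Quotient s) = f ⟦x⟧ := by
    refine (Quotient.sound ?_ : (⟦m x⟧ : Quotient s) = ⟦d x⟧).symm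
    refine ⟨1, ?_⟩
    rw [zpow_one, ht, Equiv.Perm.mul_apply, hm]
  show q ⟦d x⟧ ≠ q ⟦x⟧
  rw [this]
  exact hq ⟦x⟧

/-! ### Existence of a selection -/

namespace SimpleGraph
noncomputable section

variable {V : Type*} {G : SimpleGraph V} {χ : V → Bool}

/-- A hit that is not part of a triangle containing an edge inside a side of the cut. -/
def SimplyHits (G : SimpleGraph V) (χ : V → Bool) (x y : V) : Prop :=
  G.Hits χ x y ∧ ¬ G.Adj x (G.mate χ y) ∧ ¬ G.Adj y (G.mate χ x)

lemma SimplyHits.symm {x y : V} (h : G.SimplyHits χ x y) : G.SimplyHits χ y x :=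
  ⟨h.1.symm, h.2.2, h.2.1⟩

variable [Fintype V]

/-- A choice of one end of each edge inside a side of the cut, constant on simple hits. -/
structure IsSelection (G : SimpleGraph V) (χ : V → Bool) (R : Finset V) : Prop where
  isBad : ∀ x ∈ R, G.IsBad χ x
  mate_mem_iff : ∀ x, G.IsBad χ x → (G.mate χ x ∈ R ↔ x ∉ R)
  mem_iff : ∀ x y, G.SimplyHits χ x y → (x ∈ R ↔ y ∈ R)

omit [Fintype V] in
lemma IsSelection.isMateFree {R X : Finset V} (hR : G.IsSelection χ R) (hX : X ⊆ R) :
    G.IsMateFree χ X := fun x hx => ⟨hR.isBad x (hX hx),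
  fun hm => (hR.mate_mem_iff x (hR.isBad x (hX hx))).1 (hX hm) (hX hx)⟩

namespace IsOptimalCut
variable (h : G.IsOptimalCut χ)
include h

lemma eq_of_simplyHits {x y z : V} (hy : G.SimplyHits χ x y) (hz : G.SimplyHits χ x z) : y = z := by
  rcases h.eq_or_eq_mate_of_hits hy.1 hz.1 with H | H
  · exact H.symm
  · exact (hy.2.1 (H ▸ hz.1.2.2.1)).elim

theorem exists_isSelection : ∃ R, G.IsSelection χ R := by
  let m : {x // G.IsBad χ x} × Bool → {x // G.IsBad χ x} × Bool :=
    fun p => (⟨G.mate χ p.1, isBad_mate p.1.2⟩, p.2)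
  have hm : Function.Involutive m := fun p => by simp [m, h.mate_mate]
  -- The second coordinate doubles the set so that `d` also moves vertices without a simple hit.
  let d : {x // G.IsBad χ x} × Bool → {x // G.IsBad χ x} × Bool :=
    fun p => if H : ∃ y, G.SimplyHits χ p.1 y then (⟨H.choose, H.choose_spec.1.2.1⟩, p.2)
      else (p.1, !p.2)
  have hd1 : ∀ x y (H : G.SimplyHits χ x y) i,
      d (⟨x, H.1.1⟩, i) = (⟨y, H.1.2.1⟩, i) := by
    intro x y H i
    have H' : ∃ y, G.SimplyHits χ x y := ⟨y, H⟩
    have : H'.choose = y := h.eq_of_simplyHits H'.choose_spec H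
    simp only [d, dif_pos H', this]
  have hd : Function.Involutive d := by
    rintro ⟨⟨x, hx⟩, i⟩
    by_cases H : ∃ y, G.SimplyHits χ x y
    · obtain ⟨y, H⟩ := H
      rw [hd1 x y H, hd1 y x H.symm]
    · simp only [d, dif_neg H, Bool.not_not]
  obtain ⟨q, hq⟩ := Equiv.Perm.exists_bool_ne_of_involutive (m := hm.toPerm) (d := hd.toPerm) hm hd
    (by
      rintro ⟨⟨x, hx⟩, i⟩ heq
      exact mate_ne hx (congrArg (fun p => (p.1 : V)) heq))
    (by
      rintro ⟨⟨x, hx⟩, i⟩ heq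
      by_cases H : ∃ y, G.SimplyHits χ x y
      · obtain ⟨y, H⟩ := H
        have heq' : d (⟨x, hx⟩, i) = (⟨x, hx⟩, i) := heq
        rw [hd1 x y H] at heq'
        exact H.1.2.2.1.ne' (congrArg (fun p => (p.1 : V)) heq')
      · have heq' : d (⟨x, hx⟩, i) = (⟨x, hx⟩, i) := heq
        simp [d, H] at heq')
  have hR : ∀ x (hx : G.IsBad χ x),
      x ∈ ({x | ∃ hx : G.IsBad χ x, q (⟨x, hx⟩, true) ≠ χ x} : Finset V) ↔
        q (⟨x, hx⟩, true) ≠ χ x := by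
    intro x hx
    simp [hx]
  -- Passing to the mate changes `q` but not the side; passing along a simple hit changes both.
  refine ⟨({x | ∃ hx : G.IsBad χ x, q (⟨x, hx⟩, true) ≠ χ x} : Finset V), ?_, ?_, ?_⟩
  · intro x hx
    exact (mem_filter.1 hx).2.1
  · intro x hx
    rw [hR x hx, hR _ (isBad_mate hx), side_mate (G := G) (χ := χ)]
    have : q (⟨G.mate χ x, isBad_mate hx⟩, true) ≠ q (⟨x, hx⟩, true) := (hq (⟨x, hx⟩, true)).1
    revert this
    cases q (⟨G.mate χ x, isBad_mate hx⟩, true) <;> cases q (⟨x, hx⟩, true) <;> cases χ x <;> simp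
  · intro x y H
    rw [hR x H.1.1, hR y H.1.2.1]
    have h1 : q (d (⟨x, H.1.1⟩, true)) ≠ q (⟨x, H.1.1⟩, true) := (hq (⟨x, H.1.1⟩, true)).2
    rw [hd1 x y H] at h1
    have h2 := H.1.2.2.2
    revert h1 h2
    cases q (⟨y, H.1.2.1⟩, true) <;> cases q (⟨x, H.1.1⟩, true) <;> cases χ x <;> cases χ y <;> simp

end IsOptimalCut
end

/-! ### Link components and exchange arguments for an optimal selection -/

noncomputable section

variable {V : Type*} {G : SimpleGraph V} {χ : V → Bool}

/-- `S` is a component of the link graph on `R`. -/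
structure IsLinkComponent (G : SimpleGraph V) (χ : V → Bool) (R S : Finset V) : Prop where
  subset : S ⊆ R
  isLinked : G.IsLinked χ S
  closed : ∀ x ∈ S, ∀ y ∈ R, (G.link χ).Adj x y → y ∈ S

/-- The link graph on `S` is not bipartite. -/
def IsOddOn (G : SimpleGraph V) (χ : V → Bool) (S : Finset V) : Prop :=
  ¬ ∃ c, G.IsProperOn χ S c

/-- Both ends of an edge inside a side of the cut hit `S`, in distinct vertices. -/
def IsDoublyHit (G : SimpleGraph V) (χ : V → Bool) (S : Finset V) : Prop :=
  ∃ u, ∃ v ∈ S, ∃ z ∈ S, v ≠ z ∧ G.Hits χ u v ∧ G.Hits χ (G.mate χ u) z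

lemma IsOddOn.mono {S T : Finset V} (h : G.IsOddOn χ S) (hT : S ⊆ T) : G.IsOddOn χ T :=
  fun ⟨c, hc⟩ => h ⟨c, hc.mono hT⟩

lemma isLinked_singleton (x : V) : G.IsLinked χ {x} :=
  isLinked_of_forall (mem_singleton_self x) fun _ hY hx _ =>
    subset_antisymm hY (singleton_subset_iff.2 hx)

lemma isLinked_pair {x y : V} (hadj : (G.link χ).Adj x y) : G.IsLinked χ {x, y} :=
  isLinked_of_forall (mem_insert_self x _) fun _ hY hx hstep =>
    subset_antisymm hY (insert_subset hx (singleton_subset_iff.2 (hstep x hx y (by simp) hadj)))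

lemma IsLinked.insert {X : Finset V} (hX : G.IsLinked χ X) {x y : V} (hx : x ∈ X)
    (hadj : (G.link χ).Adj x y) : G.IsLinked χ (insert y X) := by
  have := hX.union (isLinked_pair hadj) hx (mem_insert_self x _)
  rwa [show X ∪ {x, y} = Insert.insert y X by
    rw [union_insert, union_comm, singleton_union, insert_eq_self.2 (mem_insert_of_mem hx)]] at this

namespace IsLinkComponent
variable {R S T : Finset V}

lemma subset_of_isLinked (hS : G.IsLinkComponent χ R S) (hT : G.IsLinked χ T) (hTR : T ⊆ R) {x : V}
    (hx : x ∈ S) (hx' : x ∈ T) : T ⊆ S :=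
  hT.induction (p := (· ∈ S)) hx' hx fun y _ z hz hadj hy => hS.closed y hy z (hTR hz) hadj

lemma eq (hS : G.IsLinkComponent χ R S) (hT : G.IsLinkComponent χ R T) {x : V} (hx : x ∈ S)
    (hx' : x ∈ T) : S = T :=
  subset_antisymm (hT.subset_of_isLinked hS.isLinked hS.subset hx' hx)
    (hS.subset_of_isLinked hT.isLinked hT.subset hx hx')

end IsLinkComponent

lemma exists_isLinkComponent {R : Finset V} {r : V} (hr : r ∈ R) :
    ∃ S, G.IsLinkComponent χ R S ∧ r ∈ S := by
  obtain ⟨S, hS, hmax⟩ := exists_max_image {S ∈ R.powerset | r ∈ S ∧ G.IsLinked χ S} card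
    ⟨{r}, by simp [hr, isLinked_singleton]⟩
  simp only [mem_filter, mem_powerset] at hS hmax
  refine ⟨S, ⟨hS.1, hS.2.2, fun x hx y hy hadj => ?_⟩, hS.2.1⟩
  by_contra hyS
  have := hmax (Insert.insert y S) ⟨insert_subset hy hS.1, mem_insert_of_mem hS.2.1,
    hS.2.2.insert hx hadj⟩
  rw [card_insert_of_notMem hyS] at this
  lia

/-- Components after replacing the vertex `r` by `r'`. -/
lemma IsLinkComponent.of_swap {R R' K S : Finset V} {r r' : V}
    (hR' : ∀ x, x ∈ R' ↔ x = r' ∨ x ∈ R ∧ x ≠ r) (hK : G.IsLinkComponent χ R K) (hr : r ∈ K)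
    (hS : G.IsLinkComponent χ R' S) (hr' : r' ∉ S) :
    G.IsLinkComponent χ R S ∨ S ⊆ K.erase r := by
  have hSR : ∀ x ∈ S, x ∈ R ∧ x ≠ r := fun x hx =>
    ((hR' x).1 (hS.subset hx)).resolve_left (ne_of_mem_of_not_mem hx hr')
  obtain ⟨x, hx⟩ := hS.isLinked.nonempty
  obtain ⟨L, hL, hxL⟩ := exists_isLinkComponent (G := G) (χ := χ) (hSR x hx).1
  have hSL := hL.subset_of_isLinked hS.isLinked (fun y hy => (hSR y hy).1) hxL hx
  by_cases hrL : r ∈ L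
  · right
    rw [hK.eq hL hr hrL]
    exact fun y hy => mem_erase.2 ⟨(hSR y hy).2, hSL hy⟩
  · left
    have := hS.subset_of_isLinked hL.isLinked (fun y hy => (hR' y).2 (Or.inr ⟨hL.subset hy,
      ne_of_mem_of_not_mem hy hrL⟩)) hx hxL
    rwa [subset_antisymm hSL this]

variable [Fintype V]

/-- The components of the link graph that cannot be colored directly. -/
def obstructions (G : SimpleGraph V) (χ : V → Bool) (R : Finset V) : Finset (Finset V) :=
  {S | G.IsLinkComponent χ R S ∧ (G.IsOddOn χ S ∨ G.IsDoublyHit χ S)}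

/-- The pairs of vertices of `R` joined by an edge of the cut. -/
def hitPairs (G : SimpleGraph V) (χ : V → Bool) (R : Finset V) : Finset (V × V) :=
  {p ∈ R ×ˢ R | G.Hits χ p.1 p.2}

/-- A selection with the most hits between selected vertices and, subject to this, the fewest
obstructions. -/
structure IsOptimalSelection (G : SimpleGraph V) (χ : V → Bool) (R : Finset V) : Prop
    extends G.IsSelection χ R where
  card_hitPairs_le : ∀ R', G.IsSelection χ R' → #(G.hitPairs χ R') ≤ #(G.hitPairs χ R)
  card_obstructions_le : ∀ R', G.IsSelection χ R' → #(G.hitPairs χ R) ≤ #(G.hitPairs χ R') →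
    #(G.obstructions χ R) ≤ #(G.obstructions χ R')

namespace IsOptimalCut
variable (h : G.IsOptimalCut χ)
include h

theorem exists_isOptimalSelection : ∃ R, G.IsOptimalSelection χ R := by
  obtain ⟨R₀, hR₀⟩ := h.exists_isSelection
  obtain ⟨R₁, hR₁, hmax⟩ := exists_max_image {R | G.IsSelection χ R} (fun R => #(G.hitPairs χ R))
    ⟨R₀, by simpa using hR₀⟩
  simp only [mem_filter, mem_univ, true_and] at hR₁ hmax
  obtain ⟨R, hR, hmin⟩ := exists_min_image
    {R | G.IsSelection χ R ∧ #(G.hitPairs χ R₁) ≤ #(G.hitPairs χ R)}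
    (fun R => #(G.obstructions χ R)) ⟨R₁, by simpa using hR₁⟩
  simp only [mem_filter, mem_univ, true_and] at hR hmin
  exact ⟨R, hR.1, fun R' h' => (hmax R' h').trans hR.2,
    fun R' h' hle => hmin R' ⟨h', hR.2.trans hle⟩⟩

lemma isSelection_symmDiff {R P : Finset V} (hR : G.IsSelection χ R) (hb : ∀ x ∈ P, G.IsBad χ x)
    (hm : ∀ x ∈ P, G.mate χ x ∈ P) (hP : ∀ x ∈ P, ∀ y, G.SimplyHits χ x y → y ∈ P) :
    G.IsSelection χ (symmDiff R P) := by
  refine ⟨fun x hx => ?_, fun x hx => ?_, fun x y hxy => ?_⟩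
  · rcases mem_symmDiff.1 hx with hx | hx
    exacts [hR.isBad x hx.1, hb x hx.1]
  · have h1 := hR.mate_mem_iff x hx
    have h2 : G.mate χ x ∈ P ↔ x ∈ P := ⟨fun hx' => h.mate_mate x ▸ hm _ hx', hm x⟩
    simp only [mem_symmDiff, h1, h2]
    tauto
  · have h1 := hR.mem_iff x y hxy
    have h2 : x ∈ P ↔ y ∈ P := ⟨fun hx => hP x hx y hxy, fun hy => hP y hy x hxy.symm⟩
    simp only [mem_symmDiff, h1, h2]

lemma isSelection_swap {R : Finset V} (hR : G.IsSelection χ R) {r : V} (hr : r ∈ R)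
    (h1 : ∀ y, ¬ G.SimplyHits χ r y) (h2 : ∀ y, ¬ G.SimplyHits χ (G.mate χ r) y) :
    ∃ R', G.IsSelection χ R' ∧ ∀ x, x ∈ R' ↔ x = G.mate χ r ∨ x ∈ R ∧ x ≠ r := by
  have hb := hR.isBad r hr
  have hm : G.mate χ r ∉ R := fun hm => (hR.mate_mem_iff r hb).1 hm hr
  refine ⟨symmDiff R {r, G.mate χ r}, h.isSelection_symmDiff hR ?_ ?_ ?_, fun x => ?_⟩
  · simpa using ⟨hb, isBad_mate hb⟩
  · simp [h.mate_mate]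
  · simp only [mem_insert, mem_singleton, forall_eq_or_imp, forall_eq]
    exact ⟨fun y hy => (h1 y hy).elim, fun y hy => (h2 y hy).elim⟩
  · simp only [mem_symmDiff, mem_insert, mem_singleton, not_or]
    constructor
    · rintro (⟨h1, h2, -⟩ | ⟨h1 | h1, h2⟩)
      exacts [Or.inr ⟨h1, h2⟩, (h2 (h1 ▸ hr)).elim, Or.inl h1]
    · rintro (rfl | ⟨h1, h2⟩)
      · exact Or.inr ⟨Or.inr rfl, hm⟩
      · exact Or.inl ⟨h1, h2, by rintro rfl; exact hm h1⟩

variable {R : Finset V} (hR : G.IsOptimalSelection χ R)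
include hR

omit h in
lemma mate_notMem {x : V} (hx : x ∈ R) : G.mate χ x ∉ R := fun hm =>
  (hR.mate_mem_iff x (hR.isBad x hx)).1 hm hx

/-- Otherwise exchanging the mate of `x` for `x` gains the hit on `y` and loses none. The exchange
is allowed because `x`, `y` and the mate of `y` form a triangle, so `x` has no simple hit. -/
lemma exists_hits_mate {x y : V} (hxy : G.Hits χ x y) (hy : y ∈ R) (hx : x ∉ R) :
    ∃ z ∈ R, G.Hits χ z (G.mate χ x) := by
  by_contra! hno
  have hmx : G.mate χ x ∈ R := (hR.mate_mem_iff x hxy.1).2 hx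
  have hns : ¬ G.SimplyHits χ x y := fun hs => hx ((hR.mem_iff x y hs).2 hy)
  have hymx : ¬ G.Adj y (G.mate χ x) := fun ha => hno y hy
    ⟨hxy.2.1, isBad_mate hxy.1, ha, by rw [side_mate (G := G) (χ := χ)]; exact hxy.2.2.2.symm⟩
  have hxmy : G.Adj x (G.mate χ y) := by
    by_contra hna
    exact hns ⟨hxy, hna, hymx⟩
  obtain ⟨R', hR', hmem⟩ := h.isSelection_swap hR.toIsSelection hmx
    (fun z hz => hno z ((hR.mem_iff _ z hz).1 hmx) hz.1.symm) (by
      rw [h.mate_mate]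
      intro z hz
      rcases h.eq_or_eq_mate_of_hits hxy hz.1 with rfl | rfl
      · exact hz.2.1 hxmy
      · exact hz.2.1 (by rw [h.mate_mate]; exact hxy.2.2.1))
  rw [h.mate_mate] at hmem
  have hss : G.hitPairs χ R ⊂ G.hitPairs χ R' := by
    rw [ssubset_iff_of_subset]
    · refine ⟨(x, y), ?_, ?_⟩
      · simp only [hitPairs, mem_filter, mem_product, hmem]
        refine ⟨⟨Or.inl trivial, Or.inr ⟨hy, ?_⟩⟩, hxy⟩
        rintro rfl
        exact hxy.2.2.2 (side_mate x).symm
      · simp [hitPairs, hx]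
    · rintro ⟨a, b⟩ hab
      simp only [hitPairs, mem_filter, mem_product, hmem] at hab ⊢
      refine ⟨⟨Or.inr ⟨hab.1.1, ?_⟩, Or.inr ⟨hab.1.2, ?_⟩⟩, hab.2⟩
      · rintro rfl
        exact hno b hab.1.2 hab.2.symm
      · rintro rfl
        exact hno a hab.1.1 hab.2
  have := card_lt_card hss
  have := hR.card_hitPairs_le R' hR'
  lia

omit h hR in
omit [Fintype V] in
lemma hitPairs_subset_of_swap {R R' : Finset V} {r r' : V}
    (hmem : ∀ x, x ∈ R' ↔ x = r' ∨ x ∈ R ∧ x ≠ r) (hr : ∀ y ∈ R, ¬ G.Hits χ r y) :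
    G.hitPairs χ R ⊆ G.hitPairs χ R' := by
  rintro ⟨a, b⟩ hab
  simp only [hitPairs, mem_filter, mem_product, hmem] at hab ⊢
  refine ⟨⟨Or.inr ⟨hab.1.1, ?_⟩, Or.inr ⟨hab.1.2, ?_⟩⟩, hab.2⟩
  · rintro rfl
    exact hr b hab.1.2 hab.2
  · rintro rfl
    exact hr a hab.1.1 hab.2.symm

omit hR in
lemma isDoublyHit_cases {S : Finset V} (hS : G.IsMateFree χ S) (hl : G.IsLinked χ S)
    (hd : G.IsDoublyHit χ S) {u v : V} (hv : v ∈ S) (hu : G.Hits χ u v) :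
    ∃ z ∈ S, z ≠ v ∧ G.Hits χ (G.mate χ u) z := by
  obtain ⟨u', v', hv', z', hz', hne, h1, h2⟩ := hd
  rcases h.eq_or_eq_mate_of_hits_mem hS hl hv hu hv' h1 with rfl | rfl
  · exact ⟨z', hz', by rwa [h.eq_of_hits_of_hits hS hl hv hu hv' h1, ne_comm], h2⟩
  · rw [h.mate_mate] at h2
    exact ⟨v', hv', by rwa [h.eq_of_hits_of_hits hS hl hv hu hz' h2], h1⟩

/-- One hitting end `u` is unselected, so its hit on `v` is not simple and `u` is the apex of a
triangle over `v` and its mate. Exchanging these two destroys the obstruction `S` and creates none: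
a new component through the mate is hit, hence not odd, and `not_isLinked_of_apex` forbids a double
hit. -/
theorem not_isDoublyHit {S : Finset V} (hS : G.IsLinkComponent χ R S) : ¬ G.IsDoublyHit χ S := by
  intro hd
  have hSm : G.IsMateFree χ S := hR.isMateFree hS.subset
  obtain ⟨u, v, hv, z, hz, hvz, huv, huz, huR⟩ : ∃ u, ∃ v ∈ S, ∃ z ∈ S, v ≠ z ∧ G.Hits χ u v ∧
      G.Hits χ (G.mate χ u) z ∧ u ∉ R := by
    obtain ⟨u, v, hv, z, hz, hvz, huv, huz⟩ := hd
    by_cases huR : u ∈ R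
    · refine ⟨G.mate χ u, z, hz, v, hv, hvz.symm, huz, ?_, mate_notMem hR huR⟩
      rwa [h.mate_mate]
    · exact ⟨u, v, hv, z, hz, hvz, huv, huz, huR⟩
  have hvR := hS.subset hv
  have hzR := hS.subset hz
  have hmuv : ¬ G.Hits χ (G.mate χ u) v := fun H =>
    hvz (h.eq_of_hits_of_hits hSm hS.isLinked hv H hz huz)
  have hns : ¬ G.SimplyHits χ u v := fun H => huR ((hR.mem_iff u v H).2 hvR)
  have hvmu : ¬ G.Adj v (G.mate χ u) := fun ha =>
    hmuv ⟨huz.1, huv.2.1, ha.symm, by rw [side_mate (G := G) (χ := χ)]; exact huv.2.2.2⟩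
  have huadj : G.Adj u (G.mate χ v) := by
    by_contra hna
    exact hns ⟨huv, hna, hvmu⟩
  have hum : G.Hits χ u (G.mate χ v) :=
    ⟨huv.1, isBad_mate huv.2.1, huadj, by rw [side_mate (G := G) (χ := χ)]; exact huv.2.2.2⟩
  have hvhits : ∀ y, G.Hits χ v y → y = u := fun y hy =>
    (h.eq_or_eq_mate_of_hits huv.symm hy).resolve_right fun H => hmuv (H ▸ hy.symm)
  obtain ⟨R', hR', hmem⟩ := h.isSelection_swap hR.toIsSelection hvR
    (fun y hy => hns (hvhits y hy.1 ▸ hy.symm)) (by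
      intro y hy
      rcases h.eq_or_eq_mate_of_hits hum.symm hy.1 with rfl | rfl
      · exact hy.2.2 (by rw [h.mate_mate]; exact huv.2.2.1)
      · exact hy.2.1 (by rw [h.mate_mate]; exact huadj.symm))
  have hle := hR.card_obstructions_le R' hR' (card_le_card (hitPairs_subset_of_swap hmem
    fun y hy H => huR (hvhits y H ▸ hy)))
  have hsub : G.obstructions χ R' ⊆ (G.obstructions χ R).erase S := by
    intro T hT
    obtain ⟨hT, hobs⟩ := (mem_filter.1 hT).2
    have hTm : G.IsMateFree χ T := hR'.isMateFree hT.subset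
    by_cases hmT : G.mate χ v ∈ T
    · exfalso
      have hTd := hobs.resolve_left fun hodd =>
        hodd (h.exists_isProperOn_of_hits hTm hT.isLinked hmT hum)
      obtain ⟨z', hz', hne, hmz⟩ := h.isDoublyHit_cases hTm hT.isLinked hTd hmT hum
      have hz'R : z' ∈ R := (((hmem z').1 (hT.subset hz')).resolve_left hne).1
      have hzz : z' = z := (h.eq_or_eq_mate_of_hits huz hmz).resolve_right fun H =>
        mate_notMem hR hzR (H ▸ hz'R)
      subst hzz
      have hmemX : ∀ x ∈ S ∪ T, x ∈ R ∨ x = G.mate χ v := fun x hx => (mem_union.1 hx).elim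
        (fun hx => Or.inl (hS.subset hx))
          fun hx => ((hmem x).1 (hT.subset hx)).symm.imp_left And.left
      -- Both components contain `z`, so their union is linked and contains `v` with its mate.
      refine h.not_isLinked_of_apex (hS.isLinked.union hT.isLinked hz hz') (fun x hx => ?_)
        (mem_union_left _ hv) (mem_union_right _ hmT) (fun x hx hmx => ?_) (mem_union_left _ hz)
        hvz.symm hne huv hum huz
      · rcases hmemX x hx with hx | rfl
        exacts [hR.isBad x hx, hum.2.1]
      · rcases hmemX x hx with hx | hx
        · rcases hmemX _ hmx with hx' | hx'
          · exact (mate_notMem hR hx hx').elim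
          · left
            rw [← h.mate_mate x, hx', h.mate_mate]
        · exact Or.inr hx
    · rcases hS.of_swap hmem hv hT hmT with hT' | hT'
      · refine mem_erase.2 ⟨?_, by simpa [obstructions] using ⟨hT', hobs⟩⟩
        rintro rfl
        rcases (hmem v).1 (hT.subset hv) with H | H
        exacts [mate_ne huv.2.1 H.symm, H.2 rfl]
      · exfalso
        rcases hobs with hodd | ⟨u', v', hv', z', hz', hne, h1, h2⟩
        · exact hodd.mono (hT'.trans (erase_subset _ _))
            (h.exists_isProperOn_of_hits hSm hS.isLinked hv huv)
        · have hv'' := mem_erase.1 (hT' hv')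
          have hz'' := mem_erase.1 (hT' hz')
          rcases h.eq_or_eq_mate_of_hits_mem hSm hS.isLinked hv huv hv''.2 h1 with rfl | rfl
          · exact hv''.1 (h.eq_of_hits_of_hits hSm hS.isLinked hv huv hv''.2 h1).symm
          · rw [h.mate_mate] at h2
            exact hz''.1 (h.eq_of_hits_of_hits hSm hS.isLinked hv huv hz''.2 h2).symm
  have hSobs : S ∈ G.obstructions χ R := by simpa [obstructions] using ⟨hS, Or.inr hd⟩
  have := card_le_card hsub
  have := card_erase_lt_of_mem hSobs
  lia

/-- Exchanging `r` for its mate would join the mate to `T` and leave only bipartite, unhit pieces of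
`S`. Two obstructions disappear and at most one arises. -/
theorem not_link_mate_of_odd {S T : Finset V} (hS : G.IsLinkComponent χ R S)
    (hT : G.IsLinkComponent χ R T) (hne : S ≠ T) (hSo : G.IsOddOn χ S) (hTo : G.IsOddOn χ T)
    {r s : V} (hr : r ∈ S) (hc : ∃ c, G.IsProperOn χ (S.erase r) c) (hs : s ∈ T) :
    ¬ (G.link χ).Adj s (G.mate χ r) := by
  intro hadj
  have hSm : G.IsMateFree χ S := hR.isMateFree hS.subset
  have hTm : G.IsMateFree χ T := hR.isMateFree hT.subset
  have hrR := hS.subset hr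
  have hrb := hR.isBad r hrR
  have hrT : r ∉ T := fun hrT => hne (hS.eq hT hr hrT)
  have hr1 : ∀ {y z}, z ∈ S → ¬ G.Hits χ y z := fun hz =>
    h.not_hits_of_not_isProperOn hSm hS.isLinked hSo hz
  have hXm : G.IsMateFree χ (Insert.insert (G.mate χ r) T) := by
    intro x hx
    rcases mem_insert.1 hx with rfl | hx
    · refine ⟨isBad_mate hrb, ?_⟩
      rw [h.mate_mate, mem_insert, not_or]
      exact ⟨(mate_ne hrb).symm, hrT⟩
    · refine ⟨hR.isBad x (hT.subset hx), ?_⟩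
      rw [mem_insert, not_or]
      refine ⟨fun H => hrT ?_, (hTm x hx).2⟩
      rwa [← h.mate_mate r, ← H, h.mate_mate]
  -- `T` with the mate added is still linked, mate-free and odd, hence not hit; this makes the
  -- exchange admissible.
  have hr2 : ∀ y, ¬ G.Hits χ y (G.mate χ r) := fun y =>
    h.not_hits_of_not_isProperOn hXm (hT.isLinked.insert hs hadj) (hTo.mono (subset_insert _ _))
      (mem_insert_self _ _)
  obtain ⟨R', hR', hmem⟩ := h.isSelection_swap hR.toIsSelection hrR
    (fun y hy => hr1 hr hy.1.symm) (fun y hy => hr2 y hy.1.symm)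
  have hle := hR.card_obstructions_le R' hR' (card_le_card (hitPairs_subset_of_swap hmem
    fun y _ H => hr1 hr H.symm))
  have hrR' : G.mate χ r ∈ R' := (hmem _).2 (Or.inl rfl)
  obtain ⟨C, hC, hrC⟩ := exists_isLinkComponent (G := G) (χ := χ) hrR'
  have hsub : G.obstructions χ R' ⊆
      Insert.insert C (((G.obstructions χ R).erase S).erase T) := by
    intro U hU
    obtain ⟨hU, hobs⟩ := (mem_filter.1 hU).2
    by_cases hmU : G.mate χ r ∈ U
    · rw [hU.eq hC hmU hrC]
      exact mem_insert_self _ _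
    · refine mem_insert_of_mem ?_
      rcases hS.of_swap hmem hr hU hmU with hU' | hU'
      · refine mem_erase.2 ⟨?_, mem_erase.2 ⟨?_, by simpa [obstructions] using ⟨hU', hobs⟩⟩⟩
        · rintro rfl
          exact hmU (hU.closed s hs _ hrR' hadj)
        · rintro rfl
          rcases (hmem r).1 (hU.subset hr) with H | H
          exacts [mate_ne hrb H.symm, H.2 rfl]
      · exfalso
        rcases hobs with hodd | ⟨u', v', hv', z', hz', hne, h1, h2⟩
        · exact hodd.mono hU' hc
        · exact hr1 (mem_of_mem_erase (hU' hv')) h1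
  have hSobs : S ∈ G.obstructions χ R := by simpa [obstructions] using ⟨hS, Or.inl hSo⟩
  have hTobs : T ∈ (G.obstructions χ R).erase S :=
    mem_erase.2 ⟨hne.symm, by simpa [obstructions] using ⟨hT, Or.inl hTo⟩⟩
  have h1 := card_le_card hsub
  have h2 := card_insert_le C (((G.obstructions χ R).erase S).erase T)
  have h3 := card_erase_lt_of_mem hSobs
  have h4 := card_erase_lt_of_mem hTobs
  lia

/-- Exchanging both vertices for their mates would gain this hit and lose none. -/
theorem not_hits_mate_mate {r s : V} (hr : r ∈ R) (hs : s ∈ R) (hr' : ∀ y, ¬ G.Hits χ r y)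
    (hs' : ∀ y, ¬ G.Hits χ s y) : ¬ G.Hits χ (G.mate χ r) (G.mate χ s) := by
  intro H
  set P : Finset V := {r, G.mate χ r, s, G.mate χ s} with hP
  have hsel : G.IsSelection χ (symmDiff R P) := by
    refine h.isSelection_symmDiff hR.toIsSelection ?_ ?_ ?_
    · simpa [hP] using ⟨hR.isBad r hr, H.1, hR.isBad s hs, H.2.1⟩
    · simp [hP, h.mate_mate]
    · simp only [hP, mem_insert, mem_singleton, forall_eq_or_imp, forall_eq]
      refine ⟨fun y hy => (hr' y hy.1).elim, fun y hy => ?_, fun y hy => (hs' y hy.1).elim,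
        fun y hy => ?_⟩
      · rcases h.eq_or_eq_mate_of_hits H hy.1 with rfl | rfl <;> simp [h.mate_mate]
      · rcases h.eq_or_eq_mate_of_hits H.symm hy.1 with rfl | rfl <;> simp [h.mate_mate]
  have hmr := mate_notMem hR hr
  have hms := mate_notMem hR hs
  have hss : G.hitPairs χ R ⊂ G.hitPairs χ (symmDiff R P) := by
    rw [ssubset_iff_of_subset]
    · refine ⟨(G.mate χ r, G.mate χ s), ?_, ?_⟩
      · simp [hitPairs, mem_symmDiff, hP, hmr, hms, H]
      · simp [hitPairs, hmr]
    · rintro ⟨a, b⟩ hab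
      simp only [hitPairs, mem_filter, mem_product] at hab ⊢
      have key : ∀ a ∈ R, (∃ b, G.Hits χ a b) → a ∈ symmDiff R P := by
        rintro a ha ⟨b, hab⟩
        refine mem_symmDiff.2 (Or.inl ⟨ha, ?_⟩)
        simp only [hP, mem_insert, mem_singleton]
        rintro (rfl | rfl | rfl | rfl)
        exacts [hr' b hab, hmr ha, hs' b hab, hms ha]
      exact ⟨⟨key a hab.1.1 ⟨b, hab.2⟩, key b hab.1.2 ⟨a, hab.2.symm⟩⟩, hab.2⟩
  have := card_lt_card hss
  have := hR.card_hitPairs_le _ hsel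
  lia

end IsOptimalCut
end

/-! ### The coloring of a finite graph -/

noncomputable section

variable {V : Type*} {G : SimpleGraph V} {χ : V → Bool}

/-- `w` is a vertex of the odd component `S` whose removal leaves a bipartite link graph. -/
structure IsBreaker (G : SimpleGraph V) (χ : V → Bool) (S : Finset V) (w : V) : Prop where
  mem : w ∈ S
  isOddOn : G.IsOddOn χ S
  exists_isProperOn : ∃ c, G.IsProperOn χ (S.erase w) c
  exists_adj : ∃ u ∈ S, ∃ z ∈ S, u ≠ z ∧ (G.link χ).Adj w u ∧ (G.link χ).Adj w z

/-- Two vertices too close to share the `i`-th color of a `(1, 1, 2, 2, 3)`-packing coloring. -/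
def Conflict (G : SimpleGraph V) (i : Fin 5) (u v : V) : Prop :=
  G.Adj u v ∨ (2 ≤ i ∧ ∃ a, G.Adj u a ∧ G.Adj a v) ∨
    (i = 4 ∧ ∃ a b, G.Adj u a ∧ G.Adj a b ∧ G.Adj b v)

lemma bool_eq_of_ne_of_ne {a b c : Bool} (h : a ≠ b) (h' : b ≠ c) : a = c :=
  IsOptimalCut.bool_eq_of_ne h h'.symm

namespace IsOptimalCut
variable [Fintype V] (h : G.IsOptimalCut χ)
include h

variable {R : Finset V} (hR : G.IsOptimalSelection χ R)
include hR

lemma exists_componentColoring {S : Finset V} (hS : G.IsLinkComponent χ R S) :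
    ∃ (c : V → Bool) (W : Finset V), (∀ w ∈ W, G.IsBreaker χ S w) ∧ (∀ w ∈ W, ∀ w' ∈ W, w = w') ∧
      G.IsProperOn χ (S \ W) c ∧ ∀ v ∈ S, ∀ u, G.Hits χ u v → v ∉ W ∧ c v = χ v := by
  have hSm : G.IsMateFree χ S := hR.isMateFree hS.subset
  by_cases hodd : G.IsOddOn χ S
  · obtain ⟨w, hw, ⟨c, hc⟩, hadj⟩ := hS.isLinked.exists_isProperOn_erase
      (h.card_linkEdges_le_card hSm hS.isLinked) hodd
    refine ⟨c, {w}, ?_, ?_, ?_, fun v hv u hu => ?_⟩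
    · simpa using ⟨hw, hodd, ⟨c, hc⟩, hadj⟩
    · simp
    · rwa [sdiff_singleton_eq_erase]
    · exact (h.not_hits_of_not_isProperOn hSm hS.isLinked hodd hv hu).elim
  · obtain ⟨c, hc⟩ := not_not.1 hodd
    by_cases hit : ∃ v ∈ S, ∃ u, G.Hits χ u v
    · obtain ⟨v, hv, u, hu⟩ := hit
      have huniq : ∀ v' ∈ S, ∀ u', G.Hits χ u' v' → v' = v := by
        intro v' hv' u' hu'
        by_contra hne
        rcases h.eq_or_eq_mate_of_hits_mem hSm hS.isLinked hv hu hv' hu' with rfl | rfl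
        · exact hne (h.eq_of_hits_of_hits hSm hS.isLinked hv' hu' hv hu)
        · exact h.not_isDoublyHit hR hS ⟨u, v, hv, v', hv', Ne.symm hne, hu, hu'⟩
      -- Adding a constant keeps the coloring proper and gives the only hit vertex `v` the value `χ
      -- v`.
      refine ⟨fun x => xor (c x) (xor (c v) (χ v)), ∅, by simp, by simp, ?_, ?_⟩
      · intro x hx y hy hadj heq
        rw [sdiff_empty] at hx hy
        exact hc x hx y hy hadj (by simpa using heq)
      · intro v' hv' u' hu'
        rw [huniq v' hv' u' hu']
        simp
    · refine ⟨c, ∅, by simp, by simp, by rwa [sdiff_empty], fun v hv u hu => ?_⟩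
      exact (hit ⟨v, hv, u, hu⟩).elim

/-- For vertices on opposite sides, a common neighbour is the unselected mate of one and hits the
other; `exists_hits_mate` then gives a hit on the first as well. -/
lemma link_or_hits_of_near {u v : V} (hu : u ∈ R) (hv : v ∈ R) (hne : u ≠ v)
    (hn : G.Adj u v ∨ ∃ a, G.Adj u a ∧ G.Adj a v) :
    (G.link χ).Adj u v ∨ χ u ≠ χ v ∧ (∃ y, G.Hits χ y u) ∧ ∃ y, G.Hits χ y v := by
  have hub := hR.isBad u hu
  have hvb := hR.isBad v hv
  have key : ∀ {u v a}, u ∈ R → v ∈ R → χ u ≠ χ v → G.Adj u a → G.Adj a v → χ a = χ u →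
      (∃ y, G.Hits χ y u) ∧ ∃ y, G.Hits χ y v := by
    intro u v a hu hv hs hua hav ha
    have hau := h.eq_mate hua ha.symm
    have hit : G.Hits χ a v := ⟨⟨u, hua.symm, ha⟩, hR.isBad v hv, hav, ha ▸ hs⟩
    obtain ⟨z, -, hz⟩ := h.exists_hits_mate hR hit hv (hau ▸ mate_notMem hR hu)
    rw [hau, h.mate_mate] at hz
    exact ⟨⟨z, hz⟩, a, hit⟩
  rcases hn with ha | ⟨a, hua, hav⟩
  · have hs : χ u ≠ χ v := fun hs => mate_notMem hR hu (h.eq_mate ha hs ▸ hv)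
    exact Or.inr ⟨hs, ⟨v, hvb, hub, ha.symm, hs.symm⟩, u, hub, hvb, ha, hs⟩
  · by_cases hs : χ u = χ v
    · left
      refine h.link_adj_of_common hub hvb hne (fun H => mate_notMem hR hu (H ▸ hv)) hs (b := a) ?_
        hua.symm hav
      intro ha
      exact hne (h.eq_of_same hua.symm ha hav (ha.trans hs))
    · refine Or.inr ⟨hs, ?_⟩
      by_cases ha : χ a = χ u
      · exact key hu hv hs hua hav ha
      · exact (key hv hu (Ne.symm hs) hav.symm hua.symm (bool_eq_of_ne_of_ne ha hs)).symm

/-- Two consecutive edges inside a side would retrace one edge. A middle edge alone inside a side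
gives a forbidden hit on `u`. Both outer edges, exactly one, or none inside a side are the three
exclusion results. -/
lemma not_path_of_isBreaker {S T : Finset V} (hS : G.IsLinkComponent χ R S)
    (hT : G.IsLinkComponent χ R T) (hne : S ≠ T) {u v a b : V} (hu : G.IsBreaker χ S u)
    (hv : G.IsBreaker χ T v) (huv : ¬ G.Adj u v) (hua : G.Adj u a) (hab : G.Adj a b)
    (hbv : G.Adj b v) : False := by
  have hSm : G.IsMateFree χ S := hR.isMateFree hS.subset
  have hTm : G.IsMateFree χ T := hR.isMateFree hT.subset
  have huR := hS.subset hu.mem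
  have hvR := hT.subset hv.mem
  have hub := hR.isBad u huR
  have hvb := hR.isBad v hvR
  have hneuv : u ≠ v := by
    rintro rfl
    exact hne (hS.eq hT hu.mem hv.mem)
  have hunhit := fun y => h.not_hits_of_not_isProperOn hSm hS.isLinked hu.isOddOn hu.mem (u := y)
  have hvnhit := fun y => h.not_hits_of_not_isProperOn hTm hT.isLinked hv.isOddOn hv.mem (u := y)
  have hlink : ∀ {x y c}, x ∈ R → y ∈ R → x ≠ y → χ x = χ y → G.Adj (G.mate χ x) c → G.Adj c y →
      χ c ≠ χ y → (G.link χ).Adj y (G.mate χ x) := by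
    intro x y c hx hy hxy hs hxc hcy hc
    refine h.link_adj_of_common (hR.isBad y hy) (isBad_mate (hR.isBad x hx)) ?_ ?_ ?_ hc hcy
      hxc.symm
    · rintro rfl
      exact mate_notMem hR hx hy
    · intro H
      exact hxy (by rw [← h.mate_mate x, H, h.mate_mate])
    · rw [side_mate (G := G) (χ := χ), hs]
  by_cases ha : χ a = χ u
  · have hau := h.eq_mate hua ha.symm
    by_cases hb : χ b = χ a
    · have hbu : b = u := by rw [h.eq_mate hab hb.symm, hau, h.mate_mate]
      exact huv (hbu ▸ hbv)
    · by_cases hvs : χ v = χ b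
      · have hbv' := h.eq_mate hbv.symm hvs
        refine h.not_hits_mate_mate hR huR hvR (fun y hy => hunhit y hy.symm)
          (fun y hy => hvnhit y hy.symm) ?_
        rw [← hau, ← hbv']
        exact ⟨⟨u, hua.symm, ha⟩, ⟨v, hbv, hvs.symm⟩, hab, Ne.symm hb⟩
      · have hs : χ u = χ v := ha ▸ bool_eq_of_ne (Ne.symm hb) hvs
        exact h.not_link_mate_of_odd hR hS hT hne hu.isOddOn hv.isOddOn hu.mem
          hu.exists_isProperOn hv.mem (hlink huR hvR hneuv hs (hau ▸ hab) hbv (Ne.symm hvs))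
  · by_cases hb : χ b = χ v
    · have hbv' := h.eq_mate hbv.symm hb.symm
      by_cases hc : χ a = χ b
      · have : a = v := by rw [h.eq_mate hab.symm hc.symm, hbv', h.mate_mate]
        exact huv (this ▸ hua)
      · have hs : χ v = χ u := hb ▸ bool_eq_of_ne (Ne.symm hc) (Ne.symm ha)
        exact h.not_link_mate_of_odd hR hT hS hne.symm hv.isOddOn hu.isOddOn hv.mem
          hv.exists_isProperOn hu.mem (hlink hvR huR hneuv.symm hs (hbv' ▸ hab.symm) hua.symm ha)
    · by_cases hc : χ a = χ b
      · exact hunhit a ⟨⟨b, hab, hc⟩, hub, hua.symm, ha⟩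
      · have hside : ∀ {X x}, G.IsLinkComponent χ R X → x ∈ X → ∀ y ∈ X, χ y = χ x :=
          fun hX hx y hy => hX.isLinked.side_eq hx hy
        have hSside := hside hS hu.mem
        have hTside := hside hT hv.mem
        cases hχu : χ u with
        | true =>
          have hχa : χ a = false := by simpa [hχu] using ha
          have hχb : χ b = true := by simpa [hχa] using Ne.symm hc
          have hχv : χ v = false := by simpa [hχb] using Ne.symm hb
          obtain ⟨p, hp, q, hq, hpq, hvp, hvq⟩ := hv.exists_adj
          exact h.not_adj_of_odd hSm hS.isLinked hu.isOddOn (hχu ▸ hSside) hTm hT.isLinked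
            hv.isOddOn (hχv ▸ hTside) hu.mem hv.mem hp hq hpq hvp hvq hχa hχb hua hab hbv
        | false =>
          have hχa : χ a = true := by simpa [hχu] using ha
          have hχb : χ b = false := by simpa [hχa] using Ne.symm hc
          have hχv : χ v = true := by simpa [hχb] using Ne.symm hb
          obtain ⟨p, hp, q, hq, hpq, hup, huq⟩ := hu.exists_adj
          exact h.not_adj_of_odd hTm hT.isLinked hv.isOddOn (hχv ▸ hTside) hSm hS.isLinked
            hu.isOddOn (hχu ▸ hSside) hv.mem hu.mem hp hq hpq hup huq hχb hχa hbv.symm hab.symm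
            hua.symm

theorem exists_conflictFree_coloring_of_isOptimalSelection :
    ∃ c : V → Fin 5, ∀ u v, u ≠ v → c u = c v → ¬ G.Conflict (c u) u v := by
  have hK : ∀ r, ∃ S, r ∈ R → G.IsLinkComponent χ R S ∧ r ∈ S := fun r => by
    by_cases hr : r ∈ R
    · obtain ⟨S, hS⟩ := exists_isLinkComponent (G := G) (χ := χ) hr
      exact ⟨S, fun _ => hS⟩
    · exact ⟨∅, fun hr' => (hr hr').elim⟩
  choose K hK using hK
  have hcol : ∀ S, ∃ (c : V → Bool) (W : Finset V), G.IsLinkComponent χ R S →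
      (∀ w ∈ W, G.IsBreaker χ S w) ∧ (∀ w ∈ W, ∀ w' ∈ W, w = w') ∧
      G.IsProperOn χ (S \ W) c ∧ ∀ v ∈ S, ∀ u, G.Hits χ u v → v ∉ W ∧ c v = χ v := fun S => by
    by_cases hS : G.IsLinkComponent χ R S
    · obtain ⟨c, W, H⟩ := h.exists_componentColoring hR hS
      exact ⟨c, W, fun _ => H⟩
    · exact ⟨fun _ => true, ∅, fun hS' => (hS hS').elim⟩
  choose c W hcW using hcol
  have hKadj : ∀ {u v}, u ∈ R → v ∈ R → (G.link χ).Adj u v → K v = K u := fun hu hv hadj =>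
    (hK _ hv).1.eq (hK _ hu).1 (hK _ hv).2 ((hK _ hu).1.closed _ (hK _ hu).2 _ hv hadj)
  -- Indices 0 and 1 are the colors 1, indices 2 and 3 the colors 2, and index 4 is the color 3.
  let col : V → Fin 5 := fun v =>
    if v ∈ R then (if v ∈ W (K v) then 4 else if c (K v) v then 2 else 3)
    else if χ v then 0 else 1
  have hcol1 : ∀ v, v ∉ R → col v = if χ v then 0 else 1 := fun v hv => by simp [col, hv]
  have hcol2 : ∀ v, v ∈ R → v ∉ W (K v) → col v = if c (K v) v then 2 else 3 :=
    fun v hv hv' => by simp [col, hv, hv']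
  have hcol3 : ∀ v, v ∈ R → v ∈ W (K v) → col v = 4 := fun v hv hv' => by simp [col, hv, hv']
  have hif1 : ∀ b : Bool, (if b then (0 : Fin 5) else 1) < 2 := by decide
  have hif2 : ∀ b : Bool,
      2 ≤ (if b then (2 : Fin 5) else 3) ∧ (if b then (2 : Fin 5) else 3) < 4 := by
    decide
  refine ⟨col, fun u v hne heq hconf => ?_⟩
  by_cases hu : u ∈ R
  swap
  · have hv : v ∉ R := by
      intro hv
      have h1 := hif1 (χ u)
      rw [← hcol1 u hu, heq] at h1
      by_cases hv' : v ∈ W (K v)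
      · rw [hcol3 v hv hv'] at h1
        exact absurd h1 (by decide)
      · have h2 := (hif2 (c (K v) v)).1
        rw [← hcol2 v hv hv'] at h2
        exact absurd (h1.trans_le h2) (lt_irrefl _)
    have hlt := hif1 (χ u)
    rw [← hcol1 u hu] at hlt
    rcases hconf with ha | ⟨h2, -⟩ | ⟨h4, -⟩
    · have hs : χ u = χ v := by
        rw [hcol1 u hu, hcol1 v hv] at heq
        revert heq
        cases χ u <;> cases χ v <;> simp
      have hub : G.IsBad χ u := ⟨v, ha, hs⟩
      exact hv (h.eq_mate ha hs ▸ (hR.mate_mem_iff u hub).2 hu)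
    · exact absurd (hlt.trans_le h2) (lt_irrefl _)
    · rw [h4] at hlt
      exact absurd hlt (by decide)
  · have hv : v ∈ R := by
      by_contra hv
      have h1 := hif1 (χ v)
      rw [← hcol1 v hv, ← heq] at h1
      by_cases hu' : u ∈ W (K u)
      · rw [hcol3 u hu hu'] at h1
        exact absurd h1 (by decide)
      · have h2 := (hif2 (c (K u) u)).1
        rw [← hcol2 u hu hu'] at h2
        exact absurd (h1.trans_le h2) (lt_irrefl _)
    have hnear := h.link_or_hits_of_near hR hu hv hne
    obtain ⟨hub, huu, hup, huh⟩ := hcW _ (hK u hu).1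
    obtain ⟨hvb, hvu, hvp, hvh⟩ := hcW _ (hK v hv).1
    by_cases hu' : u ∈ W (K u)
    · have hv' : v ∈ W (K v) := by
        by_contra hv'
        have h2 := (hif2 (c (K v) v)).2
        rw [← hcol2 v hv hv', ← heq, hcol3 u hu hu'] at h2
        exact lt_irrefl _ h2
      have hKne : K u ≠ K v := fun hKe => hne (huu u hu' v (hKe ▸ hv'))
      have hfar : ¬ (G.Adj u v ∨ ∃ a, G.Adj u a ∧ G.Adj a v) := fun hn => by
        rcases hnear hn with hl | ⟨-, ⟨y, hy⟩, -⟩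
        · exact hKne (hKadj hu hv hl).symm
        · exact (huh u (hK u hu).2 y hy).1 hu'
      rcases hconf with ha | ⟨-, ha⟩ | ⟨-, a, b, hua, hab, hbv⟩
      · exact hfar (Or.inl ha)
      · exact hfar (Or.inr ha)
      · exact h.not_path_of_isBreaker hR (hK u hu).1 (hK v hv).1 hKne (hub u hu') (hvb v hv')
          (fun ha => hfar (Or.inl ha)) hua hab hbv
    · have hlt := (hif2 (c (K u) u)).2
      rw [← hcol2 u hu hu'] at hlt
      have hv' : v ∉ W (K v) := by
        intro hv'
        rw [heq, hcol3 v hv hv'] at hlt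
        exact lt_irrefl _ hlt
      have hceq : c (K u) u = c (K v) v := by
        rw [hcol2 u hu hu', hcol2 v hv hv'] at heq
        revert heq
        cases c (K u) u <;> cases c (K v) v <;> simp
      have hn : G.Adj u v ∨ ∃ a, G.Adj u a ∧ G.Adj a v := by
        rcases hconf with ha | ⟨-, ha⟩ | ⟨h4, -⟩
        · exact Or.inl ha
        · exact Or.inr ha
        · rw [h4] at hlt
          exact (lt_irrefl _ hlt).elim
      rcases hnear hn with hl | ⟨hs, ⟨y, hy⟩, z, hz⟩
      · have hKe := hKadj hu hv hl
        rw [hKe] at hceq hv'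
        exact hup u (mem_sdiff.2 ⟨(hK u hu).2, hu'⟩) v
          (mem_sdiff.2 ⟨hKe ▸ (hK v hv).2, hv'⟩) hl hceq
      · rw [(huh u (hK u hu).2 y hy).2, (hvh v (hK v hv).2 z hz).2] at hceq
        exact hs hceq

end IsOptimalCut

theorem exists_conflictFree_coloring_of_fintype [Fintype V] (G : SimpleGraph V)
    (h3 : ∀ v, G.degree v ≤ 3) :
    ∃ c : V → Fin 5, ∀ u v, u ≠ v → c u = c v → ¬ G.Conflict (c u) u v := by
  obtain ⟨χ, h⟩ := G.exists_isOptimalCut h3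
  obtain ⟨R, hR⟩ := h.exists_isOptimalSelection
  exact h.exists_conflictFree_coloring_of_isOptimalSelection hR

end

/-! ### From conflicts to distances, and compactness -/

section

variable {V : Type*} {G : SimpleGraph V}

lemma isPackingColoring_of_not_conflict {c : V → Fin 5}
    (hc : ∀ u v, u ≠ v → c u = c v → ¬ G.Conflict (c u) u v) :
    G.IsPackingColoring ![1, 1, 2, 2, 3] c := by
  intro i u hu v hv huv
  obtain rfl : c u = i := hu
  have hn := hc u v huv (Eq.symm hv)
  by_contra! hle
  obtain ⟨p, hp⟩ := exists_walk_of_edist_ne_top (ne_top_of_le_ne_top (ENat.natCast_ne_top _) hle)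
  rw [← hp, Nat.cast_le] at hle
  match p with
  | .nil => exact huv rfl
  | .cons ha .nil => exact hn (Or.inl ha)
  | .cons ha (.cons hb .nil) =>
    refine hn (Or.inr (Or.inl ⟨?_, _, ha, hb⟩))
    revert hle
    generalize c u = i
    fin_cases i <;> simp
  | .cons ha (.cons hb (.cons hd .nil)) =>
    refine hn (Or.inr (Or.inr ⟨?_, _, _, ha, hb, hd⟩))
    revert hle
    generalize c u = i
    fin_cases i <;> simp
  | .cons _ (.cons _ (.cons _ (.cons _ q))) =>
    revert hle
    generalize c u = i
    simp only [Walk.length_cons]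
    fin_cases i <;> simp

/-- On a path of length at most 3 every inner vertex is adjacent to an end, so the neighbourhoods of
the ends suffice. -/
lemma Conflict.induce {B : Set V} {i : Fin 5} {u v : B} (hu : G.neighborSet u ⊆ B)
    (hv : G.neighborSet v ⊆ B) (h : G.Conflict i u v) : (G.induce B).Conflict i u v := by
  rcases h with h | ⟨hi, a, ha, hb⟩ | ⟨hi, a, b, ha, hab, hb⟩
  · exact Or.inl h
  · exact Or.inr (Or.inl ⟨hi, ⟨a, hu ha⟩, ha, hb⟩)
  · exact Or.inr (Or.inr ⟨hi, ⟨a, hu ha⟩, ⟨b, hv hb.symm⟩, ha, hab, hb⟩)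

lemma IsSubcubic.finite_neighborSet (hG : G.IsSubcubic) (v : V) : (G.neighborSet v).Finite :=
  Set.finite_of_encard_le_coe (k := 3) (hG v)

lemma IsSubcubic.degree_induce_le (hG : G.IsSubcubic) (B : Set V) [Fintype B] (v : B) :
    (G.induce B).degree v ≤ 3 := by
  have h : ((G.induce B).neighborSet v).encard ≤ 3 := by
    rw [← Subtype.val_injective.encard_image]
    refine (Set.encard_le_encard ?_).trans (hG v)
    rintro _ ⟨w, hw, rfl⟩
    exact hw
  rw [← coe_neighborFinset, Set.encard_coe_eq_coe_finsetCard, card_neighborFinset_eq_degree] at h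
  exact_mod_cast h

lemma IsSubcubic.exists_conflictFree_coloring_on (hG : G.IsSubcubic) (s : Finset V) :
    ∃ c : V → Fin 5, ∀ u ∈ s, ∀ v ∈ s, u ≠ v → c u = c v → ¬ G.Conflict (c u) u v := by
  set B : Set V := s ∪ ⋃ v ∈ s, G.neighborSet v
  have hB : B.Finite :=
    s.finite_toSet.union (s.finite_toSet.biUnion fun v _ => hG.finite_neighborSet v)
  have hsB : ∀ v ∈ s, v ∈ B := fun v hv => Or.inl hv
  have hN : ∀ v ∈ s, G.neighborSet v ⊆ B := fun v hv w hw => Or.inr (Set.mem_biUnion hv hw)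
  have := hB.fintype
  obtain ⟨c, hc⟩ := exists_conflictFree_coloring_of_fintype (G.induce B) (hG.degree_induce_le B)
  refine ⟨fun v => if hv : v ∈ B then c ⟨v, hv⟩ else 0, fun u hu v hv huv heq hconf => ?_⟩
  simp only [hsB u hu, hsB v hv, dite_true] at heq hconf
  exact hc ⟨u, hsB u hu⟩ ⟨v, hsB v hv⟩ (fun h => huv (congrArg Subtype.val h)) heq
    (Conflict.induce (hN u hu) (hN v hv) hconf)

theorem IsSubcubic.exists_conflictFree_coloring (hG : G.IsSubcubic) :
    ∃ c : V → Fin 5, ∀ u v, u ≠ v → c u = c v → ¬ G.Conflict (c u) u v := by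
  choose g hg using hG.exists_conflictFree_coloring_on
  -- The limit coloring agrees on each pair with a coloring of some finite set containing it, and
  -- conflicts concern only pairs.
  obtain ⟨c, hc⟩ := Finset.rado_selection (β := fun _ : V => Fin 5) g
  refine ⟨c, fun u v huv => ?_⟩
  obtain ⟨t, ht, hct⟩ := hc {u, v}
  rw [hct u (by simp), hct v (by simp)]
  exact hg t u (ht (by simp)) v (ht (by simp)) huv

end
end SimpleGraph

end

theorem mainTheorem2 {V : Type*} (G : SimpleGraph V) (hG : G.IsSubcubic) :
    G.PackingColorable ![1, 1, 2, 2, 3] := by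
  obtain ⟨c, hc⟩ := hG.exists_conflictFree_coloring
  exact ⟨c, SimpleGraph.isPackingColoring_of_not_conflict hc⟩
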